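/- Let $M_1$ and $M_2$ be connected smooth manifolds of dimensions $n_1\ge 1$ and $n_2\ge 1$, with conformal structures $c_1$ and $c_2$ (equivalence classes of Riemannian metrics modulo multiplication by positive smooth functions). Let $c$ be a conformal structure on $M=M_1\times M_2$ which is a conformal product of $(M_1,c_1)$ and $(M_2,c_2)$, i.e. the canonical projections $p_i:(M,c)\to (M_i,c_i)$ are conformal submersions whose vertical spaces $\ker dp_1$ and $\ker dp_2$ are orthogonal at each point. Let $H_1=\ker dp_2$ and $H_2=\ker dp_1$, and let $D$ be the adapted Weyl structure of $c$, i.e. the (unique) torsion-free connection on $TM$ which preserves $c$ and for which $H_1$ and $H_2$ are parallel. Suppose that the conformal product is non-closed, i.e. it is not true that every point of $M$ has an open neighbourhood on which $D$ is the Levi-Civita connection of some metric in the conformal class. If $n_1+n_2$ is neither $2$ nor $4$, then the only $D$-parallel distributions (smooth subbundles) of $TM$, other than the trivial ones $0$ and $TM$, are $H_1$ and $H_2$. -/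

import Mathlib

open Bundle Set
open scoped Manifold ContDiff Topology

noncomputable section

namespace WeylGeometry

section General

variable {E : Type*} [NormedAddCommGroup E] [NormedSpace ℝ E] [FiniteDimensional ℝ E]
  {H : Type*} [TopologicalSpace H] (I : ModelWithCorners ℝ E H)
  (M : Type*) [TopologicalSpace M] [ChartedSpace H M] [IsManifold I ∞ M]

/-! ### Conformal structures -/

/-- Smooth Riemannian metrics on the manifold `M`. -/
abbrev Metric : Type _ :=
  ContMDiffRiemannianMetric I ∞ E (TangentSpace I : M → Type _)

variable {I M}

/-- Two metrics are conformal to each other if they differ by a positive smooth function. -/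
def ConformallyEquivalent (g g' : Metric I M) : Prop :=
  ∃ f : M → ℝ, ContMDiff I 𝓘(ℝ, ℝ) ∞ f ∧ (∀ x, 0 < f x) ∧
    ∀ (x : M) (v w : TangentSpace I x), g'.inner x v w = f x * g.inner x v w

variable (I M)

/-- Conformal equivalence as an equivalence relation. -/
def conformalSetoid : Setoid (Metric I M) where
  r := ConformallyEquivalent
  iseqv :=
    { refl := fun g => ⟨fun _ => 1, contMDiff_const, fun _ => one_pos, fun x v w => by simp⟩
      symm := by
        rintro g g' ⟨f, hf, hpos, h⟩
        refine ⟨fun x => (f x)⁻¹, fun x => (hf x).inv₀ (hpos x).ne',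
          fun x => inv_pos.2 (hpos x), fun x v w => ?_⟩
        rw [h, inv_mul_cancel_left₀ (hpos x).ne']
      trans := by
        rintro g g' g'' ⟨f, hf, hpos, h⟩ ⟨f', hf', hpos', h'⟩
        refine ⟨fun x => f' x * f x, hf'.mul hf, fun x => mul_pos (hpos' x) (hpos x),
          fun x v w => ?_⟩
        rw [h', h, mul_assoc] }

/-- A conformal structure on `M`: an equivalence class of Riemannian metrics modulo
conformal rescalings. -/
def ConformalStructure : Type _ := Quotient (conformalSetoid I M)

variable {I M}

/-- The metric `g` belongs to the conformal class `c`. -/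
def ConformalStructure.Contains (c : ConformalStructure I M) (g : Metric I M) : Prop :=
  Quotient.mk (conformalSetoid I M) g = c

/-! ### Distributions -/

variable (I M) in
/-- A family of subspaces of the tangent spaces of `M`. -/
abbrev TangentSubspaces : Type _ := (x : M) → Submodule ℝ (TangentSpace I x)

/-- The family `Δ` is a (smooth) distribution, i.e. a smooth subbundle of `TM`:
near each point it is spanned by a smooth local frame. -/
def IsSmoothDistribution (Δ : TangentSubspaces I M) : Prop :=
  ∀ x : M, ∃ U : Set M, IsOpen U ∧ x ∈ U ∧
    ∃ (r : ℕ) (s : Fin r → (y : M) → TangentSpace I y),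
      (∀ i, CMDiff[U] ∞ (T% (s i))) ∧
      ∀ y ∈ U, LinearIndependent ℝ (fun i => s i y) ∧
        Submodule.span ℝ (Set.range (fun i => s i y)) = Δ y

/-- The family `Δ` is parallel for the connection `D`: if `Y` is a smooth section of `Δ` over an
open set, then so is `D_X Y`, for all vectors `X`. (Here `D Y x X` is `D_X Y` at `x`.) -/
def IsParallelDistribution (D : CovariantDerivative I E (TangentSpace I : M → Type _))
    (Δ : TangentSubspaces I M) : Prop :=
  ∀ U : Set M, IsOpen U → ∀ Y : (y : M) → TangentSpace I y, CMDiff[U] ∞ (T% Y) →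
    (∀ y ∈ U, Y y ∈ Δ y) → ∀ x ∈ U, ∀ X : TangentSpace I x, D Y x X ∈ Δ x

/-! ### Weyl structures -/

/-- The covariant derivative `(D_X b)(Y, Z) = X(b(Y, Z)) - b(D_X Y, Z) - b(Y, D_X Z)` at `x` of a
field of bilinear forms `b`. -/
def covDerivBilin (D : CovariantDerivative I E (TangentSpace I : M → Type _))
    (b : (x : M) → TangentSpace I x →L[ℝ] TangentSpace I x →L[ℝ] ℝ)
    (Y Z : (x : M) → TangentSpace I x) (x : M) (X : TangentSpace I x) : ℝ :=
  d% (fun y => b y (Y y) (Z y)) x X - b x (D Y x X) (Z x) - b x (Y x) (D Z x X)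

/-- `θ` is the Lee form of `D` with respect to `g`: `D_X g = -2 θ(X) g`. Equivalently, the
positive section `l` of the weight bundle with `c = g l²` satisfies `D_X l = θ(X) l` when
`D c = 0`. -/
def IsLeeForm (D : CovariantDerivative I E (TangentSpace I : M → Type _)) (g : Metric I M)
    (θ : (x : M) → TangentSpace I x →L[ℝ] ℝ) : Prop :=
  ∀ (Y Z : (x : M) → TangentSpace I x) (x : M), MDiffAt (T% Y) x → MDiffAt (T% Z) x →
    ∀ X : TangentSpace I x,
      covDerivBilin D g.inner Y Z x X = -2 * θ x X * g.inner x (Y x) (Z x)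

/-- A Weyl structure on `(M, c)`: a smooth torsion-free connection on `TM` which preserves the
conformal structure `c`. -/
structure IsWeylStructure (c : ConformalStructure I M)
    (D : CovariantDerivative I E (TangentSpace I : M → Type _)) : Prop where
  smooth : ContMDiffCovariantDerivativeOn E ∞ D.toFun Set.univ
  torsion_free : D.torsion = 0
  preserves : ∀ g : Metric I M, c.Contains g → ∃ θ, IsLeeForm D g θ

/-- The Weyl structure `D` is closed: near each point some metric `f g` of the conformal class is
`D`-parallel. (Positive local sections of the weight bundle are the same as local metrics in the
class; as `D` is torsion-free, it is then the Levi-Civita connection of `f g`.) -/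
def IsClosedWeyl (c : ConformalStructure I M)
    (D : CovariantDerivative I E (TangentSpace I : M → Type _)) : Prop :=
  ∀ x : M, ∃ U : Set M, IsOpen U ∧ x ∈ U ∧
    ∃ (g : Metric I M) (f : M → ℝ), c.Contains g ∧
      CMDiff[U] ∞ f ∧ (∀ y ∈ U, 0 < f y) ∧
      ∀ (Y Z : (y : M) → TangentSpace I y), ∀ y ∈ U, MDiffAt (T% Y) y → MDiffAt (T% Z) y →
        ∀ X : TangentSpace I y, covDerivBilin D (fun z => f z • g.inner z) Y Z y X = 0

end General

/-! ### Conformal submersions -/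

section Submersions

variable {E : Type*} [NormedAddCommGroup E] [NormedSpace ℝ E] [FiniteDimensional ℝ E]
  {H : Type*} [TopologicalSpace H] {I : ModelWithCorners ℝ E H}
  {M : Type*} [TopologicalSpace M] [ChartedSpace H M] [IsManifold I ∞ M]
  {E' : Type*} [NormedAddCommGroup E'] [NormedSpace ℝ E'] [FiniteDimensional ℝ E']
  {H' : Type*} [TopologicalSpace H'] {I' : ModelWithCorners ℝ E' H'}
  {N : Type*} [TopologicalSpace N] [ChartedSpace H' N] [IsManifold I' ∞ N]

variable (I I') in
/-- The vertical distribution `ker dp` of a map `p`. -/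
def vertical (p : M → N) : TangentSubspaces I M :=
  fun x => LinearMap.ker (mfderiv I I' p x).toLinearMap

/-- `p : (M, c) → (N, c')` is a conformal submersion: a smooth submersion whose differential
restricts to a conformal isomorphism from `(ker dp)^⊥` onto the tangent space of `N`. -/
structure IsConformalSubmersion (c : ConformalStructure I M) (c' : ConformalStructure I' N)
    (p : M → N) : Prop where
  smooth : ContMDiff I I' ∞ p
  surjective : ∀ x, Function.Surjective (mfderiv I I' p x)
  conformal : ∀ (g : Metric I M) (g' : Metric I' N), c.Contains g → c'.Contains g' →
    ∀ x : M, ∃ r : ℝ, 0 < r ∧ ∀ v w : TangentSpace I x,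
      (∀ u ∈ vertical I I' p x, g.inner x u v = 0) →
      (∀ u ∈ vertical I I' p x, g.inner x u w = 0) →
      g'.inner (p x) (mfderiv I I' p x v) (mfderiv I I' p x w) = r * g.inner x v w

end Submersions

/-! ### Conformal products -/

section Products

variable {E₁ : Type*} [NormedAddCommGroup E₁] [NormedSpace ℝ E₁] [FiniteDimensional ℝ E₁]
  {B₁ : Type*} [TopologicalSpace B₁] (I₁ : ModelWithCorners ℝ E₁ B₁)
  (M₁ : Type*) [TopologicalSpace M₁] [ChartedSpace B₁ M₁] [IsManifold I₁ ∞ M₁]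
  {E₂ : Type*} [NormedAddCommGroup E₂] [NormedSpace ℝ E₂] [FiniteDimensional ℝ E₂]
  {B₂ : Type*} [TopologicalSpace B₂] (I₂ : ModelWithCorners ℝ E₂ B₂)
  (M₂ : Type*) [TopologicalSpace M₂] [ChartedSpace B₂ M₂] [IsManifold I₂ ∞ M₂]

/-- The distribution `H₁ = ker dp₂`, tangent to the slices `M₁ × {y}`. -/
def factor₁ : TangentSubspaces (I₁.prod I₂) (M₁ × M₂) :=
  vertical (I₁.prod I₂) I₂ Prod.snd

/-- The distribution `H₂ = ker dp₁`, tangent to the slices `{x} × M₂`. -/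
def factor₂ : TangentSubspaces (I₁.prod I₂) (M₁ × M₂) :=
  vertical (I₁.prod I₂) I₁ Prod.fst

variable {I₁ M₁ I₂ M₂}

/-- `c` is a conformal product of `(M₁, c₁)` and `(M₂, c₂)`: the two projections are conformal
submersions with orthogonal kernels. -/
structure IsConformalProduct (c₁ : ConformalStructure I₁ M₁) (c₂ : ConformalStructure I₂ M₂)
    (c : ConformalStructure (I₁.prod I₂) (M₁ × M₂)) : Prop where
  fst : IsConformalSubmersion c c₁ (Prod.fst : M₁ × M₂ → M₁)
  snd : IsConformalSubmersion c c₂ (Prod.snd : M₁ × M₂ → M₂)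
  orthogonal : ∀ g : Metric (I₁.prod I₂) (M₁ × M₂), c.Contains g →
    ∀ x, ∀ u ∈ factor₁ I₁ M₁ I₂ M₂ x, ∀ v ∈ factor₂ I₁ M₁ I₂ M₂ x, g.inner x u v = 0

/-- `D` is the adapted Weyl structure of the conformal product `c`: the (unique) Weyl structure
which preserves both factors of the splitting `TM = H₁ ⊕ H₂`. -/
structure IsAdaptedWeylStructure (c : ConformalStructure (I₁.prod I₂) (M₁ × M₂))
    (D : CovariantDerivative (I₁.prod I₂) (E₁ × E₂)
      (TangentSpace (I₁.prod I₂) : M₁ × M₂ → Type _)) : Prop where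
  weyl : IsWeylStructure c D
  parallel₁ : IsParallelDistribution D (factor₁ I₁ M₁ I₂ M₂)
  parallel₂ : IsParallelDistribution D (factor₂ I₁ M₁ I₂ M₂)

end Products

end WeylGeometry

end

/-!
Let `H₁`, `H₂` be the two factors, `g` a metric in the class, `θ` the Lee form of `D` with respect
to `g` (so `D g = -2 θ ⊗ g`) and `F = dθ` its Faraday form.

In a product chart `H₁` and `H₂` are constant subspaces `P` and `Q`. As `D` is torsion-free and
preserves both, its Christoffel symbols with one argument in `P` and one in `Q` vanish
(`christoffel_eq_zero`). Hence, along `Q`, the metric on `P` changes only by the conformal factor,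
and `θ` restricted to `Q` is the differential of `-log (g e e) / 2` along `Q`, for any `e ∈ P`.
It follows that `F` vanishes on `P × P` and on `Q × Q` (`faraday_eq_zero_of_mem`), and that the
mixed curvature is determined by `F` and `g` (`fderiv_christoffel_eq`): for `u, s ∈ P` and
`a, t ∈ Q`,
`R(u, a) (s + t) = F(u, a) (s + t) + (F(s, a) u - g(u, s) b(a)) + (F(u, t) a - g(a, t) b'(u))`,
where `b(a) ∈ P` and `b'(u) ∈ Q` are dual to `F(·, a)` on `P` and to `F(u, ·)` on `Q`.

If the mixed part of `F` vanished everywhere, then `θ` would be locally exact by the Poincaré lemma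
and `D` would be closed (`exists_conformal_factor`, `isClosedWeyl_of_conformal_factor`). So there is
a point at which it does not. There a subspace that is invariant under all `R(u, a)` is `0`, `P`,
`Q`, everything, or the graph of an isomorphism between `P` and `Q`; this is because the operators
`s ↦ F(s, a) u - g(u, s) b(a)` on `P` leave no proper nonzero subspace of `P` stable
(`eq_of_stable`). A graph forces `dim P = dim Q`, which by the assumption on the dimension is at
least three, and then three pairwise orthogonal vectors of `Q` lead to a contradiction
(`false_of_graph`).

A parallel distribution is invariant under the curvature, so at one point it is one of the four
candidates. Its rank is locally constant, and so is the property of being contained in `H₁` or in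
`H₂`, by uniqueness for linear differential equations (`exists_open_le_of_le`). As the manifold is
connected, the distribution is the same candidate everywhere.
-/

noncomputable section

namespace WeylGeometry

/-! ### Subspaces invariant under the mixed curvature -/

section Algebra

variable {V : Type*} [NormedAddCommGroup V] [NormedSpace ℝ V]

/-- `W` is invariant under the mixed curvature of an adapted Weyl structure at a point. Here `P` and
`Q` are the two factors, `G` is the metric, `F` the Faraday form, `b a` the `G`-dual in `P` of
`F(·, a)` and `b' u` the `G`-dual in `Q` of `F(u, ·)`. The vector in the last field is
`R(u, a) (s + t) - F(u, a) (s + t)`, so that its membership in `W` is the same as that of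
`R(u, a) (s + t)`. The factors are not assumed to be orthogonal. -/
structure MixedCurvatureInvariant (P Q : Submodule ℝ V) (G F : V →L[ℝ] V →L[ℝ] ℝ) (b b' : V → V)
    (W : Submodule ℝ V) : Prop where
  symm : ∀ v w, G v w = G w v
  pos : ∀ v, v ≠ 0 → 0 < G v v
  mem_b : ∀ a, b a ∈ P
  mem_b' : ∀ u, b' u ∈ Q
  b_dual : ∀ a, ∀ w ∈ P, G (b a) w = F w a
  b'_dual : ∀ u, ∀ c ∈ Q, G (b' u) c = F u c
  invariant : ∀ u ∈ P, ∀ a ∈ Q, ∀ s ∈ P, ∀ t ∈ Q, s + t ∈ W →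
    (F s a • u - G u s • b a) + (F u t • a - G a t • b' u) ∈ W

namespace MixedCurvatureInvariant

variable {P Q : Submodule ℝ V} {G F : V →L[ℝ] V →L[ℝ] ℝ} {b b' : V → V} {W : Submodule ℝ V}

theorem swap (h : MixedCurvatureInvariant P Q G F b b' W) :
    MixedCurvatureInvariant Q P G F.flip b' b W where
  symm := h.symm
  pos := h.pos
  mem_b := h.mem_b'
  mem_b' := h.mem_b
  b_dual a w hw := h.b'_dual a w hw
  b'_dual u c hc := h.b_dual u c hc
  invariant u hu a ha s hs t ht hst := by
    have := h.invariant a ha u hu t ht s hs (by rwa [add_comm])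
    rw [add_comm] at this
    simpa using this

theorem eq_zero_of_self (h : MixedCurvatureInvariant P Q G F b b' W) {v : V} (hv : G v v = 0) :
    v = 0 := by
  by_contra hne
  exact (h.pos v hne).ne' hv

/-- A nonzero subspace of `P` that is stable under the operators
`s ↦ F s a • u - G u s • b a` is all of `P`: these operators are the `G`-skew maps `u ∧ b a`. -/
theorem eq_of_stable (h : MixedCurvatureInvariant P Q G F b b' W)
    (hF : ∃ u ∈ P, ∃ a ∈ Q, F u a ≠ 0) {W' : Submodule ℝ V} (hW' : W' ≤ P)
    (hst : ∀ u ∈ P, ∀ a ∈ Q, ∀ s ∈ W', F s a • u - G u s • b a ∈ W')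
    (hne : W' ≠ ⊥) : W' = P := by
  -- Some element of `W'` is not orthogonal to the image of `b`.
  have key : ∃ s ∈ W', ∃ a ∈ Q, F s a ≠ 0 := by
    by_contra! hcon
    obtain ⟨s, hs, hs0⟩ := Submodule.exists_mem_ne_zero_of_ne_bot hne
    obtain ⟨u, hu, a, ha, hua⟩ := hF
    have h1 := hst s (hW' hs) a ha s hs
    rw [hcon s hs a ha, zero_smul, zero_sub, neg_mem_iff] at h1
    have h2 : b a ∈ W' := (W'.smul_mem_iff (h.pos s hs0).ne').1 h1
    have h3 : b a = 0 := by
      apply h.eq_zero_of_self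
      rw [h.b_dual a _ (h.mem_b a), hcon _ h2 a ha]
    apply hua
    rw [← h.b_dual a u hu, h3]
    simp
  obtain ⟨s, hs, a, ha, hsa⟩ := key
  refine le_antisymm hW' fun u hu => ?_
  have hs0 : s ≠ 0 := by rintro rfl; simp at hsa
  have hss := (h.pos s hs0).ne'
  set u' := u - (G u s / G s s) • s with hu'
  have hu's : G u' s = 0 := by simp [hu', hss]
  have h1 := hst u' (sub_mem hu (P.smul_mem _ (hW' hs))) a ha s hs
  rw [hu's, zero_smul, sub_zero] at h1
  have h2 : u' ∈ W' := (W'.smul_mem_iff hsa).1 h1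
  have : u = u' + (G u s / G s s) • s := by simp [hu']
  rw [this]
  exact add_mem h2 (W'.smul_mem _ hs)

/-- An invariant subspace that meets `P` contains it. -/
theorem le_of_inf_ne_bot (h : MixedCurvatureInvariant P Q G F b b' W)
    (hF : ∃ u ∈ P, ∃ a ∈ Q, F u a ≠ 0) (hne : P ⊓ W ≠ ⊥) : P ≤ W := by
  have : P ⊓ W = P := by
    refine h.eq_of_stable hF inf_le_left (fun u hu a ha s hs => ?_) hne
    have := h.invariant u hu a ha s hs.1 0 Q.zero_mem (by simpa using hs.2)
    refine ⟨sub_mem (P.smul_mem _ hu) (P.smul_mem _ (h.mem_b a)), by simpa using this⟩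
  exact inf_eq_left.1 this

/-- The projection of an invariant subspace to `P` along `Q` is surjective if it is nonzero. -/
theorem exists_add_mem (h : MixedCurvatureInvariant P Q G F b b' W)
    (hF : ∃ u ∈ P, ∃ a ∈ Q, F u a ≠ 0) (hPQ : IsCompl P Q) (hne : ¬ W ≤ Q) :
    ∀ s ∈ P, ∃ t ∈ Q, s + t ∈ W := by
  have : P ⊓ (W ⊔ Q) = P := by
    refine h.eq_of_stable hF inf_le_left (fun u hu a ha s hs => ?_) fun hbot => ?_
    · obtain ⟨w, hw, q, hq, hwq⟩ := Submodule.mem_sup.1 hs.2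
      refine ⟨sub_mem (P.smul_mem _ hu) (P.smul_mem _ (h.mem_b a)), ?_⟩
      have := h.invariant u hu a ha s hs.1 (-q) (neg_mem hq) (by rw [← hwq]; simpa using hw)
      refine Submodule.mem_sup.2 ⟨_, this, -(F u (-q) • a - G a (-q) • b' u), ?_, by abel⟩
      exact neg_mem (sub_mem (Q.smul_mem _ ha) (Q.smul_mem _ (h.mem_b' u)))
    · apply hne
      intro w hw
      obtain ⟨p, hp, q, hq, hpq⟩ := Submodule.mem_sup.1
        (show w ∈ P ⊔ Q by rw [hPQ.sup_eq_top]; trivial)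
      have : p ∈ P ⊓ (W ⊔ Q) :=
        ⟨hp, Submodule.mem_sup.2 ⟨w, hw, -q, neg_mem hq, by rw [← hpq]; abel⟩⟩
      rw [hbot, Submodule.mem_bot] at this
      rw [← hpq, this, zero_add]
      exact hq
  intro s hs
  obtain ⟨w, hw, q, hq, hwq⟩ := Submodule.mem_sup.1 (this.ge hs).2
  exact ⟨-q, neg_mem hq, by rw [← hwq]; simpa using hw⟩

/-! If `W` is the graph of an isomorphism between `P` and `Q`, then `s + t ∈ W` for `s ∈ P`, `t ∈ Q`
expresses that `t` is the image of `s`. The hypothesis `hdim` says that `Q` has dimension at least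
three: any two linear forms have a common nonzero zero in `Q`. -/

section Graph

/-- In the case of a graph, the Faraday form does not degenerate on `Q`. -/
theorem b_ne_zero (h : MixedCurvatureInvariant P Q G F b b' W)
    (hF : ∃ u ∈ P, ∃ a ∈ Q, F u a ≠ 0) (hQ : Q ⊓ W = ⊥)
    (hfull : ∀ t ∈ Q, ∃ s ∈ P, s + t ∈ W) {a : V} (ha : a ∈ Q) (ha0 : a ≠ 0) : b a ≠ 0 := by
  intro hba
  obtain ⟨u, hu, c, hc, huc⟩ := hF
  obtain ⟨s, hs, hst⟩ := hfull a ha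
  have h1 := h.invariant u hu a ha s hs a ha hst
  have h2 : ∀ w ∈ P, F w a = 0 := fun w hw => by rw [← h.b_dual a w hw, hba]; simp
  rw [h2 s hs, hba, h2 u hu, zero_smul, zero_smul, smul_zero, sub_zero, zero_add, zero_sub,
    neg_mem_iff, W.smul_mem_iff (h.pos a ha0).ne'] at h1
  have h3 : b' u ∈ Q ⊓ W := ⟨h.mem_b' u, h1⟩
  rw [hQ, Submodule.mem_bot] at h3
  rw [← h.b'_dual u c hc, h3] at huc
  simp at huc

/-- In the case of a graph, `b' (b a)` is a multiple of `a`: apply the curvature in the directions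
`b a` and `a`. -/
theorem smul_b'_b (h : MixedCurvatureInvariant P Q G F b b' W) (hQ : Q ⊓ W = ⊥)
    (hfull : ∀ t ∈ Q, ∃ s ∈ P, s + t ∈ W) {a : V} (ha : a ∈ Q) :
    G a a • b' (b a) = G (b a) (b a) • a := by
  obtain ⟨s, hs, hst⟩ := hfull a ha
  have h1 := h.invariant (b a) (h.mem_b a) a ha s hs a ha hst
  rw [h.b_dual a s hs, sub_self, zero_add, ← h.b_dual a _ (h.mem_b a)] at h1
  have h3 : G (b a) (b a) • a - G a a • b' (b a) ∈ Q ⊓ W :=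
    ⟨sub_mem (Q.smul_mem _ ha) (Q.smul_mem _ (h.mem_b' _)), h1⟩
  rw [hQ, Submodule.mem_bot] at h3
  exact (sub_eq_zero.1 h3).symm

/-- If `t` is the image of `s`, then `s` is orthogonal to the kernel of `F(·, t)` on `P`: choose
`a` orthogonal to `t` and in the kernel of `F(u, ·)`, and apply the curvature in the directions
`u` and `a`. -/
theorem orthogonal_of_graph (h : MixedCurvatureInvariant P Q G F b b' W)
    (hF : ∃ u ∈ P, ∃ a ∈ Q, F u a ≠ 0) (hP : P ⊓ W = ⊥) (hQ : Q ⊓ W = ⊥)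
    (hfull : ∀ t ∈ Q, ∃ s ∈ P, s + t ∈ W)
    (hdim : ∀ f g : V →L[ℝ] ℝ, ∃ a ∈ Q, a ≠ 0 ∧ f a = 0 ∧ g a = 0)
    {s t u : V} (hs : s ∈ P) (ht : t ∈ Q) (hst : s + t ∈ W) (hu : u ∈ P) (hut : F u t = 0) :
    G u s = 0 := by
  obtain ⟨a, ha, ha0, hat, hua⟩ := hdim (G t) (F u)
  have h1 := h.invariant u hu a ha s hs t ht hst
  rw [hut, h.symm a t, hat, zero_smul, zero_smul, sub_zero, add_zero] at h1
  have h2 : F s a • u - G u s • b a ∈ P ⊓ W :=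
    ⟨sub_mem (P.smul_mem _ hu) (P.smul_mem _ (h.mem_b a)), h1⟩
  rw [hP, Submodule.mem_bot] at h2
  have h3 := congrArg (G (b a)) h2
  simp only [map_sub, map_smul, smul_eq_mul, map_zero] at h3
  rw [h.b_dual a u hu, hua, mul_zero, zero_sub, neg_eq_zero, mul_eq_zero] at h3
  exact h3.resolve_right (h.pos _ (h.b_ne_zero hF hQ hfull ha ha0)).ne'

/-- If `t` is the image of `s`, then `s` is a multiple of `b t`. -/
theorem smul_eq_of_graph (h : MixedCurvatureInvariant P Q G F b b' W)
    (hF : ∃ u ∈ P, ∃ a ∈ Q, F u a ≠ 0) (hP : P ⊓ W = ⊥) (hQ : Q ⊓ W = ⊥)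
    (hfull : ∀ t ∈ Q, ∃ s ∈ P, s + t ∈ W)
    (hdim : ∀ f g : V →L[ℝ] ℝ, ∃ a ∈ Q, a ≠ 0 ∧ f a = 0 ∧ g a = 0)
    {s t : V} (hs : s ∈ P) (ht : t ∈ Q) (hst : s + t ∈ W) :
    G (b t) (b t) • s = F s t • b t := by
  have hu : G (b t) (b t) • s - F s t • b t ∈ P :=
    sub_mem (P.smul_mem _ hs) (P.smul_mem _ (h.mem_b t))
  have h0 : F (G (b t) (b t) • s - F s t • b t) t = 0 := by
    simp only [map_sub, map_smul, sub_apply, smul_apply,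
      smul_eq_mul]
    rw [← h.b_dual t (b t) (h.mem_b t)]
    ring
  have h1 := h.orthogonal_of_graph hF hP hQ hfull hdim hs ht hst hu h0
  have h2 := h.b_dual t _ hu
  rw [h0] at h2
  rw [← sub_eq_zero]
  apply h.eq_zero_of_self
  rw [map_sub (G _), map_smul, map_smul, h1, h.symm (G (b t) (b t) • s - F s t • b t) (b t), h2,
    smul_zero, smul_zero, sub_zero]

/-- If `t` is the image of `s` and `a` is orthogonal to `t`, then `F(s, t) a` is the image of
`-g(s, s) b(a)`: apply the curvature in the directions `s` and `a`. -/
theorem graph_step (h : MixedCurvatureInvariant P Q G F b b' W)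
    (hF : ∃ u ∈ P, ∃ a ∈ Q, F u a ≠ 0) (hP : P ⊓ W = ⊥) (hQ : Q ⊓ W = ⊥)
    (hfull : ∀ t ∈ Q, ∃ s ∈ P, s + t ∈ W)
    (hdim : ∀ f g : V →L[ℝ] ℝ, ∃ a ∈ Q, a ≠ 0 ∧ f a = 0 ∧ g a = 0)
    {s t a : V} (hs : s ∈ P) (ht : t ∈ Q) (ht0 : t ≠ 0) (hst : s + t ∈ W) (ha : a ∈ Q)
    (hat : G a t = 0) : -(G s s • b a) + F s t • a ∈ W := by
  have h1 := h.invariant s hs a ha s hs t ht hst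
  have hbt := (h.pos _ (h.b_ne_zero hF hQ hfull ht ht0)).ne'
  have h2 : F s a = 0 := by
    have e1 := congrArg (fun v => F v a) (h.smul_eq_of_graph hF hP hQ hfull hdim hs ht hst)
    have e2 := congrArg (fun v => G v a) (h.smul_b'_b hQ hfull ht)
    simp only [map_smul, smul_apply, smul_eq_mul] at e1 e2
    rw [h.b'_dual _ a ha, h.symm t a, hat, mul_zero, mul_eq_zero] at e2
    rw [e2.resolve_left (h.pos t ht0).ne', mul_zero, mul_eq_zero] at e1
    exact e1.resolve_left hbt
  rwa [h2, hat, zero_smul, zero_smul, zero_sub, sub_zero] at h1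

/-- In dimension at least three an invariant subspace is not the graph of an isomorphism. With
`s + t ∈ W` and `t, a, c` pairwise orthogonal, `graph_step` produces two elements of `W` with
`Q`-component along `c`, once directly and once through `a`; their `P`-components are both along
`b c`, but the two resulting ratios have opposite signs. -/
theorem false_of_graph (h : MixedCurvatureInvariant P Q G F b b' W)
    (hF : ∃ u ∈ P, ∃ a ∈ Q, F u a ≠ 0) (hP : P ⊓ W = ⊥) (hQ : Q ⊓ W = ⊥)
    (hfull : ∀ t ∈ Q, ∃ s ∈ P, s + t ∈ W)
    (hdim : ∀ f g : V →L[ℝ] ℝ, ∃ a ∈ Q, a ≠ 0 ∧ f a = 0 ∧ g a = 0) : False := by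
  obtain ⟨t, ht, ht0, -⟩ := hdim 0 0
  obtain ⟨s, hs, hst⟩ := hfull t ht
  obtain ⟨a, ha, ha0, hta, -⟩ := hdim (G t) 0
  obtain ⟨c, hc, hc0, htc, hac⟩ := hdim (G t) (G a)
  have hs0 : s ≠ 0 := by
    rintro rfl
    have : t ∈ Q ⊓ W := ⟨ht, by simpa using hst⟩
    rw [hQ, Submodule.mem_bot] at this
    exact ht0 this
  have hba := h.pos _ (h.b_ne_zero hF hQ hfull ha ha0)
  have hbc := h.b_ne_zero hF hQ hfull hc hc0
  have hss := h.pos s hs0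
  have hFst : F s t ≠ 0 := by
    intro h0
    have := h.smul_eq_of_graph hF hP hQ hfull hdim hs ht hst
    rw [h0, zero_smul, smul_eq_zero] at this
    exact this.elim (h.pos _ (h.b_ne_zero hF hQ hfull ht ht0)).ne' hs0
  have h1 := h.graph_step hF hP hQ hfull hdim hs ht ht0 hst hc (by rw [h.symm, htc])
  have h2 := h.graph_step hF hP hQ hfull hdim hs ht ht0 hst ha (by rw [h.symm, hta])
  have h3 := h.graph_step hF hP hQ hfull hdim (neg_mem (P.smul_mem _ (h.mem_b a)))
    (Q.smul_mem _ ha) (smul_ne_zero hFst ha0) h2 hc (by rw [map_smul, h.symm, hac, smul_zero])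
  have hb := h.b_dual a _ (h.mem_b a)
  simp only [map_neg, map_smul, neg_apply, smul_apply,
    smul_eq_mul, ← hb] at h3
  have h4 := sub_mem (W.smul_mem (F s t) h3) (W.smul_mem (-(F s t * (G s s * G (b a) (b a)))) h1)
  have h5 : -(F s t * (G s s * (G s s * G (b a) (b a))) +
      F s t * (G s s * G (b a) (b a)) * G s s) • b c ∈ P ⊓ W := by
    refine ⟨P.smul_mem _ (h.mem_b c), ?_⟩
    change _ ∈ W
    convert h4 using 1
    module
  rw [hP, Submodule.mem_bot, smul_eq_zero] at h5
  have h6 := h5.resolve_right hbc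
  have h7 : F s t * (2 * (G s s * (G s s * G (b a) (b a)))) = 0 := by linarith
  exact mul_ne_zero hFst (by positivity) h7

end Graph

/-- Classification of the subspaces that are invariant under the mixed curvature, if the mixed part
of the Faraday form does not vanish. Only the graph of an isomorphism `P ≃ Q` has to be excluded
besides the evident cases; the dimensions of `P` and `Q` are then equal, hence at least three. -/
theorem eq_bot_or_eq_or_eq_or_eq_top [FiniteDimensional ℝ V]
    (h : MixedCurvatureInvariant P Q G F b b' W)
    (hF : ∃ u ∈ P, ∃ a ∈ Q, F u a ≠ 0) (hPQ : IsCompl P Q)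
    (h2 : Module.finrank ℝ V ≠ 2) (h4 : Module.finrank ℝ V ≠ 4) :
    W = ⊥ ∨ W = P ∨ W = Q ∨ W = ⊤ := by
  have hF' : ∃ a ∈ Q, ∃ u ∈ P, F.flip a u ≠ 0 := by
    obtain ⟨u, hu, a, ha, hua⟩ := hF
    exact ⟨a, ha, u, hu, hua⟩
  by_cases hP : P ⊓ W = ⊥
  · by_cases hQ : Q ⊓ W = ⊥
    · left
      by_contra hW
      have hfull1 := h.exists_add_mem hF hPQ fun hle => hW (by rwa [inf_eq_right.2 hle] at hQ)
      have hfull2 : ∀ t ∈ Q, ∃ s ∈ P, s + t ∈ W := by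
        intro t ht
        obtain ⟨s, hs, hst⟩ := h.swap.exists_add_mem hF' hPQ.symm
          (fun hle => hW (by rwa [inf_eq_right.2 hle] at hP)) t ht
        exact ⟨s, hs, by rwa [add_comm]⟩
      -- `W` is a common complement of `P` and `Q`, so that these have the same dimension.
      have e1 : IsCompl P W := by
        refine ⟨disjoint_iff.2 hP, codisjoint_iff.2 ?_⟩
        rw [eq_top_iff, ← hPQ.sup_eq_top]
        refine sup_le le_sup_left fun t ht => ?_
        obtain ⟨s, hs, hst⟩ := hfull2 t ht
        exact Submodule.mem_sup.2 ⟨-s, neg_mem hs, _, hst, by abel⟩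
      have e2 : IsCompl Q W := by
        refine ⟨disjoint_iff.2 hQ, codisjoint_iff.2 ?_⟩
        rw [eq_top_iff, ← hPQ.sup_eq_top]
        refine sup_le (fun s hs => ?_) le_sup_left
        obtain ⟨t, ht, hst⟩ := hfull1 s hs
        exact Submodule.mem_sup.2 ⟨-t, neg_mem ht, _, hst, by abel⟩
      have d1 := Submodule.finrank_add_eq_of_isCompl e1
      have d2 := Submodule.finrank_add_eq_of_isCompl e2
      have d3 := Submodule.finrank_add_eq_of_isCompl hPQ
      have hQ1 : Module.finrank ℝ Q ≠ 0 := by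
        obtain ⟨u, hu, a, ha, hua⟩ := hF
        intro h0
        have := Submodule.finrank_eq_zero.1 h0
        rw [this, Submodule.mem_bot] at ha
        simp [ha] at hua
      -- Two linear forms have a common zero on `Q`, the dimension of `Q` being at least three.
      refine h.false_of_graph hF hP hQ hfull2 fun f g => ?_
      let φ : Q →ₗ[ℝ] ℝ × ℝ := (f.toLinearMap.prod g.toLinearMap).comp Q.subtype
      have hker : LinearMap.ker φ ≠ ⊥ := by
        intro hbot
        have := LinearMap.finrank_le_finrank_of_injective (LinearMap.ker_eq_bot.1 hbot)
        simp only [Module.finrank_prod, Module.finrank_self] at this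
        omega
      obtain ⟨a, ha, ha0⟩ := Submodule.exists_mem_ne_zero_of_ne_bot hker
      have := LinearMap.mem_ker.1 ha
      refine ⟨a, a.2, by simpa using ha0, congrArg Prod.fst this, congrArg Prod.snd this⟩
    · have hle := h.swap.le_of_inf_ne_bot hF' hQ
      right; right; left
      refine le_antisymm (fun w hw => ?_) hle
      obtain ⟨p, hp, q, hq, rfl⟩ := Submodule.mem_sup.1
        (show w ∈ P ⊔ Q by rw [hPQ.sup_eq_top]; trivial)
      have : p ∈ P ⊓ W := ⟨hp, by simpa using sub_mem hw (hle hq)⟩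
      rw [hP, Submodule.mem_bot] at this
      simpa [this] using hq
  · have hle := h.le_of_inf_ne_bot hF hP
    by_cases hQ : Q ⊓ W = ⊥
    · right; left
      refine le_antisymm (fun w hw => ?_) hle
      obtain ⟨p, hp, q, hq, rfl⟩ := Submodule.mem_sup.1
        (show w ∈ P ⊔ Q by rw [hPQ.sup_eq_top]; trivial)
      have : q ∈ Q ⊓ W := ⟨hq, by simpa using sub_mem hw (hle hp)⟩
      rw [hQ, Submodule.mem_bot] at this
      simpa [this] using hp
    · right; right; right
      rw [eq_top_iff, ← hPQ.sup_eq_top]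
      exact sup_le hle (h.swap.le_of_inf_ne_bot hF' hQ)

end MixedCurvatureInvariant
end Algebra

/-! ### Adapted Weyl structures in flat coordinates -/

section Local

variable {V : Type*} [NormedAddCommGroup V] [NormedSpace ℝ V] [FiniteDimensional ℝ V]

/-- An adapted Weyl structure on an open subset `Ω` of a vector space whose two factors are the
constant complementary distributions `P` and `Q`. The metric is `G`, the connection is the flat one
plus the Christoffel form `Γ`, with `Γ z u v` the covariant derivative at `z` of the constant field
`v` in the direction `u`, and `θ` is the Lee form. Smoothness of `θ` is not required: it is a
consequence (`contDiffOn_lee`). -/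
structure IsLocalAdaptedWeyl (P Q : Submodule ℝ V) (Ω : Set V) (G : V → V →L[ℝ] V →L[ℝ] ℝ)
    (Γ : V → V →L[ℝ] V →L[ℝ] V) (θ : V → V →L[ℝ] ℝ) : Prop where
  isOpen : IsOpen Ω
  isCompl : IsCompl P Q
  ne_bot₁ : P ≠ ⊥
  ne_bot₂ : Q ≠ ⊥
  smooth_metric : ∀ v w, ContDiffOn ℝ ∞ (fun z => G z v w) Ω
  symm : ∀ z ∈ Ω, ∀ v w, G z v w = G z w v
  pos : ∀ z ∈ Ω, ∀ v, v ≠ 0 → 0 < G z v v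
  smooth_christoffel : ∀ u v, ContDiffOn ℝ ∞ (fun z => Γ z u v) Ω
  torsion_free : ∀ z ∈ Ω, ∀ u v, Γ z u v = Γ z v u
  preserves₁ : ∀ z ∈ Ω, ∀ u, ∀ v ∈ P, Γ z u v ∈ P
  preserves₂ : ∀ z ∈ Ω, ∀ u, ∀ v ∈ Q, Γ z u v ∈ Q
  metric : ∀ z ∈ Ω, ∀ u v w, fderiv ℝ (fun y => G y v w) z u =
    -2 * θ z u * G z v w + G z (Γ z u v) w + G z v (Γ z u w)

/-- The Faraday form: the exterior derivative of the Lee form. -/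
def faraday (θ : V → V →L[ℝ] ℝ) (z : V) : V →L[ℝ] V →L[ℝ] ℝ :=
  fderiv ℝ θ z - (fderiv ℝ θ z).flip

omit [FiniteDimensional ℝ V] in
theorem faraday_apply (θ : V → V →L[ℝ] ℝ) (z u a : V) :
    faraday θ z u a = fderiv ℝ θ z u a - fderiv ℝ θ z a u := rfl

omit [FiniteDimensional ℝ V] in
theorem fderiv_fderiv_comm {F : Type*} [NormedAddCommGroup F] [NormedSpace ℝ F] {Ω : Set V}
    (hΩ : IsOpen Ω) {h : V → F} (hh : ContDiffOn ℝ ∞ h Ω) {z : V} (hz : z ∈ Ω) (u a : V) :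
    fderiv ℝ (fun y => fderiv ℝ h y u) z a = fderiv ℝ (fun y => fderiv ℝ h y a) z u := by
  have h1 : ContDiffAt ℝ ∞ h z := hh.contDiffAt (hΩ.mem_nhds hz)
  have h2 : DifferentiableAt ℝ (fderiv ℝ h) z :=
    (h1.fderiv_right (m := 1) (by norm_cast)).differentiableAt one_ne_zero
  have h3 : IsSymmSndFDerivAt ℝ h z := h1.isSymmSndFDerivAt (by simp; norm_cast)
  rw [fderiv_clm_apply h2 (differentiableAt_const _),
    fderiv_clm_apply h2 (differentiableAt_const _)]
  simpa using h3.eq a u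

omit [FiniteDimensional ℝ V] in
theorem hasFDerivAt_apply {F : Type*} [NormedAddCommGroup F] [NormedSpace ℝ F]
    {T : V → V →L[ℝ] F} {z : V} (hT : DifferentiableAt ℝ T z) (x : V) :
    HasFDerivAt (fun y => T y x) ((fderiv ℝ T z).flip x) z :=
  ((ContinuousLinearMap.apply ℝ F x).hasFDerivAt.comp z hT.hasFDerivAt).congr_fderiv rfl

omit [FiniteDimensional ℝ V] in
theorem hasFDerivAt_apply₂ {F : Type*} [NormedAddCommGroup F] [NormedSpace ℝ F]
    {T : V → V →L[ℝ] V →L[ℝ] F} {z : V} (hT : DifferentiableAt ℝ T z) (x y : V) :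
    HasFDerivAt (fun w => T w x y) (((fderiv ℝ T z).flip x).flip y) z :=
  ((ContinuousLinearMap.apply ℝ F y).hasFDerivAt.comp z (hasFDerivAt_apply hT x)).congr_fderiv rfl

omit [FiniteDimensional ℝ V] in
/-- The derivative of a function with values in a subspace has values in that subspace. -/
theorem fderiv_mem_of_forall_mem {F : Type*} [NormedAddCommGroup F] [NormedSpace ℝ F]
    [FiniteDimensional ℝ F] {Ω : Set V} (hΩ : IsOpen Ω)
    {h : V → F} {S : Submodule ℝ F} (hS : ∀ y ∈ Ω, h y ∈ S) {z : V} (hz : z ∈ Ω)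
    (hd : DifferentiableAt ℝ h z) (v : V) : fderiv ℝ h z v ∈ S := by
  have h1 := hd.hasFDerivAt.comp_hasDerivAt_of_eq (0 : ℝ)
    (((hasDerivAt_id (0 : ℝ)).smul_const v).const_add z) (by simp)
  simp only [id, one_smul] at h1
  have hcl : IsClosed (S : Set F) := S.closed_of_finiteDimensional
  refine hcl.mem_of_tendsto h1.tendsto_slope_zero ?_
  have h2 : ∀ᶠ t : ℝ in 𝓝[≠] 0, z + t • v ∈ Ω := by
    apply Filter.Eventually.filter_mono nhdsWithin_le_nhds
    have : ContinuousAt (fun t : ℝ => z + t • v) 0 := by fun_prop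
    exact this.eventually_mem (hΩ.mem_nhds (by simpa using hz))
  filter_upwards [h2] with t ht
  simp only [zero_add, Function.comp, zero_smul, add_zero]
  exact S.smul_mem _ (sub_mem (hS _ ht) (hS _ hz))

namespace IsLocalAdaptedWeyl

variable {P Q : Submodule ℝ V} {Ω : Set V} {G : V → V →L[ℝ] V →L[ℝ] ℝ}
    {Γ : V → V →L[ℝ] V →L[ℝ] V} {θ : V → V →L[ℝ] ℝ}

omit [FiniteDimensional ℝ V] in
theorem swap (h : IsLocalAdaptedWeyl P Q Ω G Γ θ) : IsLocalAdaptedWeyl Q P Ω G Γ θ :=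
  { h with
    isCompl := h.isCompl.symm
    ne_bot₁ := h.ne_bot₂
    ne_bot₂ := h.ne_bot₁
    preserves₁ := h.preserves₂
    preserves₂ := h.preserves₁ }

omit [FiniteDimensional ℝ V] in
/-- The mixed Christoffel symbols vanish, being in `Q` since `a ∈ Q`, and in `P` by symmetry. -/
theorem christoffel_eq_zero (h : IsLocalAdaptedWeyl P Q Ω G Γ θ) {z : V} (hz : z ∈ Ω) {u a : V}
    (hu : u ∈ P) (ha : a ∈ Q) : Γ z u a = 0 := by
  have : Γ z u a ∈ P ⊓ Q :=
    ⟨by rw [h.torsion_free z hz]; exact h.preserves₁ z hz _ _ hu, h.preserves₂ z hz _ _ ha⟩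
  rwa [h.isCompl.inf_eq_bot] at this

omit [FiniteDimensional ℝ V] in
theorem christoffel_eq_zero' (h : IsLocalAdaptedWeyl P Q Ω G Γ θ) {z : V} (hz : z ∈ Ω) {u a : V}
    (hu : u ∈ P) (ha : a ∈ Q) : Γ z a u = 0 :=
  h.swap.christoffel_eq_zero hz ha hu

theorem contDiffOn_metric (h : IsLocalAdaptedWeyl P Q Ω G Γ θ) : ContDiffOn ℝ ∞ G Ω :=
  contDiffOn_clm_apply.2 fun v => contDiffOn_clm_apply.2 fun w => h.smooth_metric v w

theorem contDiffOn_christoffel (h : IsLocalAdaptedWeyl P Q Ω G Γ θ) : ContDiffOn ℝ ∞ Γ Ω :=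
  contDiffOn_clm_apply.2 fun v => contDiffOn_clm_apply.2 fun w => h.smooth_christoffel v w

omit [FiniteDimensional ℝ V] in
/-- Along `Q` the metric on `P` only changes by a factor. -/
theorem fderiv_metric (h : IsLocalAdaptedWeyl P Q Ω G Γ θ) {z : V} (hz : z ∈ Ω) {a v w : V}
    (ha : a ∈ Q) (hv : v ∈ P) (hw : w ∈ P) :
    fderiv ℝ (fun y => G y v w) z a = -2 * θ z a * G z v w := by
  rw [h.metric z hz, h.christoffel_eq_zero' hz hv ha, h.christoffel_eq_zero' hz hw ha]
  simp

omit [FiniteDimensional ℝ V] in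
/-- On `Q`, the Lee form is a logarithmic derivative of the metric on `P`. -/
theorem contDiffOn_lee_apply (h : IsLocalAdaptedWeyl P Q Ω G Γ θ) {a : V} (ha : a ∈ Q) :
    ContDiffOn ℝ ∞ (fun z => θ z a) Ω := by
  obtain ⟨e, he, he0⟩ := Submodule.exists_mem_ne_zero_of_ne_bot h.ne_bot₁
  have h1 : ContDiffOn ℝ ∞ (fun z => fderiv ℝ (fun y => G y e e) z a) Ω :=
    ((h.smooth_metric e e).fderiv_of_isOpen h.isOpen (by simp)).clm_apply contDiffOn_const
  have h2 : ContDiffOn ℝ ∞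
      (fun z => (-1 / 2 : ℝ) * (fderiv ℝ (fun y => G y e e) z a / G z e e)) Ω :=
    contDiffOn_const.mul (h1.div (h.smooth_metric e e) fun z hz => (h.pos z hz e he0).ne')
  refine h2.congr fun z hz => ?_
  have := (h.pos z hz e he0).ne'
  simp only [h.fderiv_metric hz ha he he]
  field_simp

theorem contDiffOn_lee (h : IsLocalAdaptedWeyl P Q Ω G Γ θ) : ContDiffOn ℝ ∞ θ Ω := by
  refine contDiffOn_clm_apply.2 fun v => ?_
  obtain ⟨p, hp, q, hq, rfl⟩ := Submodule.mem_sup.1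
    (show v ∈ P ⊔ Q by rw [h.isCompl.sup_eq_top]; trivial)
  simpa using (h.swap.contDiffOn_lee_apply hp).add (h.contDiffOn_lee_apply hq)

section Pointwise

variable (h : IsLocalAdaptedWeyl P Q Ω G Γ θ) {z : V} (hz : z ∈ Ω)
include h hz

theorem differentiableAt_metric : DifferentiableAt ℝ G z :=
  (h.contDiffOn_metric.contDiffAt (h.isOpen.mem_nhds hz)).differentiableAt (by simp)

theorem differentiableAt_christoffel : DifferentiableAt ℝ Γ z :=
  (h.contDiffOn_christoffel.contDiffAt (h.isOpen.mem_nhds hz)).differentiableAt (by simp)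

theorem differentiableAt_lee : DifferentiableAt ℝ θ z :=
  (h.contDiffOn_lee.contDiffAt (h.isOpen.mem_nhds hz)).differentiableAt (by simp)

end Pointwise

theorem fderiv_christoffel_mem (h : IsLocalAdaptedWeyl P Q Ω G Γ θ) {z : V} (hz : z ∈ Ω) (x u : V)
    {v : V} (hv : v ∈ P) : fderiv ℝ Γ z x u v ∈ P := by
  have hd := hasFDerivAt_apply₂ (h.differentiableAt_christoffel hz) u v
  have := fderiv_mem_of_forall_mem h.isOpen (fun y hy => h.preserves₁ y hy u v hv) hz
    hd.differentiableAt x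
  rwa [hd.fderiv] at this

theorem fderiv_christoffel_comm (h : IsLocalAdaptedWeyl P Q Ω G Γ θ) {z : V} (hz : z ∈ Ω)
    (x u v : V) : fderiv ℝ Γ z x u v = fderiv ℝ Γ z x v u := by
  have hd := h.differentiableAt_christoffel hz
  have e : ∀ u v, fderiv ℝ Γ z x u v = fderiv ℝ (fun y => Γ y u v) z x := fun u v => by
    rw [(hasFDerivAt_apply₂ hd u v).fderiv]
    rfl
  rw [e, e]
  congr 1
  apply Filter.EventuallyEq.fderiv_eq
  filter_upwards [h.isOpen.mem_nhds hz] with y hy using h.torsion_free y hy u v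

theorem fderiv_christoffel_eq_zero (h : IsLocalAdaptedWeyl P Q Ω G Γ θ) {z : V} (hz : z ∈ Ω)
    (x : V) {u a : V} (hu : u ∈ P) (ha : a ∈ Q) : fderiv ℝ Γ z x u a = 0 := by
  have : fderiv ℝ Γ z x u a ∈ P ⊓ Q :=
    ⟨by rw [h.fderiv_christoffel_comm hz]; exact h.fderiv_christoffel_mem hz _ _ hu,
      h.swap.fderiv_christoffel_mem hz _ _ ha⟩
  rwa [h.isCompl.inf_eq_bot] at this

/-- The mixed curvature is skew for the metric, up to a multiple of the Faraday form. This is the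
symmetry of the second derivatives of `G v w` in the directions `u` and `a`, which the compatibility
of the connection with the metric expresses through `Γ` and `θ`. Since the mixed Christoffel symbols
vanish, `-fderiv ℝ Γ z a u` is the curvature in the directions `u` and `a` on `P`. -/
theorem metric_curvature (h : IsLocalAdaptedWeyl P Q Ω G Γ θ) {z : V} (hz : z ∈ Ω)
    {u a v w : V} (ha : a ∈ Q) (hv : v ∈ P) (hw : w ∈ P) :
    G z (fderiv ℝ Γ z a u v) w + G z v (fderiv ℝ Γ z a u w) =
      -2 * faraday θ z u a * G z v w := by
  have hG := h.differentiableAt_metric hz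
  have hΓ := h.differentiableAt_christoffel hz
  have hθ := h.differentiableAt_lee hz
  have hΓ' := hasFDerivAt_apply₂ hΓ
  have hGvw := hasFDerivAt_apply₂ hG v w
  have hθ' := hasFDerivAt_apply hθ
  have hGx : ∀ x ∈ P, ∀ y ∈ P, fderiv ℝ G z a x y = -2 * θ z a * G z x y := by
    intro x hx y hy
    rw [← h.fderiv_metric hz ha hx hy, (hasFDerivAt_apply₂ hG x y).fderiv]
    rfl
  have hR := (((hθ' u).const_mul (-2)).mul hGvw).add
      ((hG.hasFDerivAt.clm_apply (hΓ' u v)).clm_apply (hasFDerivAt_const w z)) |>.add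
      ((hG.hasFDerivAt.clm_apply (hasFDerivAt_const v z)).clm_apply (hΓ' u w))
  have hL := ((hθ' a).const_mul (-2)).mul hGvw
  -- The second derivative of `G v w`, in either order, from the formulas for the first one.
  have e1 : fderiv ℝ (fun y => fderiv ℝ (fun y => G y v w) y u) z a = _ :=
    congrArg (fun L => L a) ((hR.congr_of_eventuallyEq (by
      filter_upwards [h.isOpen.mem_nhds hz] with y hy
      rw [h.metric y hy]; simp)).fderiv)
  have e2 : fderiv ℝ (fun y => fderiv ℝ (fun y => G y v w) y a) z u = _ :=
    congrArg (fun L => L u) ((hL.congr_of_eventuallyEq (by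
      filter_upwards [h.isOpen.mem_nhds hz] with y hy
      rw [h.fderiv_metric hy ha hv hw]; simp)).fderiv)
  rw [fderiv_fderiv_comm h.isOpen (h.smooth_metric v w) hz u a, e2] at e1
  have e3 := h.metric z hz u v w
  rw [hGvw.fderiv] at e3
  simp at e1 e3
  rw [hGx _ hv _ hw, hGx _ (h.preserves₁ z hz u v hv) _ hw, hGx _ hv _ (h.preserves₁ z hz u w hw),
    e3] at e1
  rw [faraday_apply]
  linarith

end IsLocalAdaptedWeyl
/-! ### Parallel distributions and mixed curvature -/

/-- Riesz representation in a subspace, for a form that is positive definite. -/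
theorem exists_dual_mem {G : V →L[ℝ] V →L[ℝ] ℝ} (hpos : ∀ v, v ≠ 0 → 0 < G v v)
    (P : Submodule ℝ V) (f : V →L[ℝ] ℝ) : ∃ b ∈ P, ∀ w ∈ P, G b w = f w := by
  let φ : P →ₗ[ℝ] Module.Dual ℝ P :=
    { toFun := fun p => (G p).toLinearMap.comp P.subtype
      map_add' := fun x y => by ext; simp
      map_smul' := fun c x => by ext; simp }
  have hinj : Function.Injective φ := by
    rw [injective_iff_map_eq_zero]
    intro x hx
    by_contra hne
    have h1 := hpos x (by simpa using hne)
    have h2 : G x x = 0 := congrArg (fun L => L x) hx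
    exact h1.ne' h2
  have hsurj := (LinearMap.injective_iff_surjective_of_finrank_eq_finrank
    (Subspace.dual_finrank_eq (K := ℝ) (V := P)).symm).1 hinj
  obtain ⟨b, hb⟩ := hsurj (f.toLinearMap.comp P.subtype)
  exact ⟨b, b.2, fun w hw => congrArg (fun L => L ⟨w, hw⟩) hb⟩

/-- The family of subspaces `W` is a smooth distribution on `Ω`, parallel for the connection with
Christoffel form `Γ`. -/
structure IsLocalParallel (Ω : Set V) (Γ : V → V →L[ℝ] V →L[ℝ] V) (W : V → Submodule ℝ V) :
    Prop where
  frame : ∀ z ∈ Ω, ∃ O, IsOpen O ∧ z ∈ O ∧ O ⊆ Ω ∧ ∃ (r : ℕ) (s : Fin r → V → V),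
    (∀ i, ContDiffOn ℝ ∞ (s i) O) ∧ ∀ y ∈ O, LinearIndependent ℝ (fun i => s i y) ∧
      Submodule.span ℝ (Set.range fun i => s i y) = W y
  parallel : ∀ O, IsOpen O → O ⊆ Ω → ∀ s : V → V, ContDiffOn ℝ ∞ s O → (∀ y ∈ O, s y ∈ W y) →
    ∀ y ∈ O, ∀ v, fderiv ℝ s y v + Γ y v (s y) ∈ W y

omit [FiniteDimensional ℝ V] in
/-- Each vector of a distribution extends to a local section. -/
theorem IsLocalParallel.exists_section {Ω : Set V} {Γ : V → V →L[ℝ] V →L[ℝ] V}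
    {W : V → Submodule ℝ V} (hW : IsLocalParallel Ω Γ W) {z v : V} (hz : z ∈ Ω) (hv : v ∈ W z) :
    ∃ O, IsOpen O ∧ z ∈ O ∧ O ⊆ Ω ∧ ∃ s : V → V, ContDiffOn ℝ ∞ s O ∧ (∀ y ∈ O, s y ∈ W y) ∧
      s z = v := by
  obtain ⟨O, hO, hzO, hOΩ, r, s, hs, hW'⟩ := hW.frame z hz
  rw [← (hW' z hzO).2, Submodule.mem_span_range_iff_exists_fun] at hv
  obtain ⟨c, hc⟩ := hv
  refine ⟨O, hO, hzO, hOΩ, fun y => ∑ i, c i • s i y,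
    ContDiffOn.sum fun i _ => contDiffOn_const.smul (hs i), fun y hy => ?_, hc⟩
  rw [← (hW' y hy).2]
  exact Submodule.sum_mem _ fun i _ => Submodule.smul_mem _ _ (Submodule.subset_span ⟨i, rfl⟩)

namespace IsLocalAdaptedWeyl

variable {P Q : Submodule ℝ V} {Ω : Set V} {G : V → V →L[ℝ] V →L[ℝ] ℝ}
    {Γ : V → V →L[ℝ] V →L[ℝ] V} {θ : V → V →L[ℝ] ℝ}

/-- The mixed curvature on `P` in terms of the Faraday form. As in the Koszul formula, it is
determined by its symmetry in `u` and `v` and by `metric_curvature`. -/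
theorem metric_curvature_eq (h : IsLocalAdaptedWeyl P Q Ω G Γ θ) {z : V} (hz : z ∈ Ω)
    {u a v w : V} (ha : a ∈ Q) (hu : u ∈ P) (hv : v ∈ P) (hw : w ∈ P) :
    G z (fderiv ℝ Γ z a u v) w = -faraday θ z u a * G z v w - faraday θ z v a * G z u w +
      faraday θ z w a * G z u v := by
  have h1 := h.metric_curvature hz (u := u) ha hv hw
  have h2 := h.metric_curvature hz (u := v) ha hu hw
  have h3 := h.metric_curvature hz (u := w) ha hu hv
  rw [h.fderiv_christoffel_comm hz a v u, h.symm z hz u] at h2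
  rw [h.fderiv_christoffel_comm hz a w u, h.fderiv_christoffel_comm hz a w v,
    h.symm z hz _ v, h.symm z hz u] at h3
  linarith

/-- The mixed curvature on `P` as a vector of `P`, where `b` is dual to `faraday θ z · a`. -/
theorem fderiv_christoffel_eq (h : IsLocalAdaptedWeyl P Q Ω G Γ θ) {z : V} (hz : z ∈ Ω)
    {u a v b : V} (ha : a ∈ Q) (hu : u ∈ P) (hv : v ∈ P) (hb : b ∈ P)
    (hbd : ∀ w ∈ P, G z b w = faraday θ z w a) :
    fderiv ℝ Γ z a u v = -faraday θ z u a • v - faraday θ z v a • u + G z u v • b := by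
  have hmem : fderiv ℝ Γ z a u v -
      (-faraday θ z u a • v - faraday θ z v a • u + G z u v • b) ∈ P :=
    sub_mem (h.fderiv_christoffel_mem hz a u hv)
      (add_mem (sub_mem (P.smul_mem _ hv) (P.smul_mem _ hu)) (P.smul_mem _ hb))
  rw [← sub_eq_zero]
  by_contra hne
  refine (h.pos z hz _ hne).ne' ?_
  set x := fderiv ℝ Γ z a u v -
      (-faraday θ z u a • v - faraday θ z v a • u + G z u v • b) with hx
  have e1 := h.metric_curvature_eq hz ha hu hv hmem
  have e2 := hbd _ hmem
  have e3 : ∀ y, G z x y = G z (fderiv ℝ Γ z a u v) y -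
      (-faraday θ z u a * G z v y - faraday θ z v a * G z u y + G z u v * G z b y) := fun y => by
    simp only [hx, map_sub, map_add, map_smul, sub_apply, add_apply, smul_apply, smul_eq_mul]
  rw [e3, e1, e2]
  ring

/-- A parallel distribution is invariant under the mixed curvature: take a section through the
given vector and commute its second covariant derivatives. -/
theorem curvature_mem (h : IsLocalAdaptedWeyl P Q Ω G Γ θ) {W : V → Submodule ℝ V}
    (hW : IsLocalParallel Ω Γ W) {z : V} (hz : z ∈ Ω) {u a p q : V} (hu : u ∈ P) (ha : a ∈ Q)
    (hp : p ∈ P) (hq : q ∈ Q) (hpq : p + q ∈ W z) :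
    fderiv ℝ Γ z u a q - fderiv ℝ Γ z a u p ∈ W z := by
  obtain ⟨O, hO, hzO, hOΩ, s, hs, hsW, hsz⟩ := hW.exists_section hz hpq
  have hsmooth : ∀ v, ContDiffOn ℝ ∞ (fun y => fderiv ℝ s y v + Γ y v (s y)) O := fun v =>
    ((hs.fderiv_of_isOpen hO (by simp)).clm_apply contDiffOn_const).add
      (((h.contDiffOn_christoffel.mono hOΩ).clm_apply contDiffOn_const).clm_apply hs)
  have hmem : ∀ v, ∀ y ∈ O, fderiv ℝ s y v + Γ y v (s y) ∈ W y :=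
    fun v y hy => hW.parallel O hO hOΩ s hs hsW y hy v
  have hs' : ContDiffAt ℝ ∞ s z := hs.contDiffAt (hO.mem_nhds hzO)
  have hds : HasFDerivAt s (fderiv ℝ s z) z := (hs'.differentiableAt (by simp)).hasFDerivAt
  have hd2 : DifferentiableAt ℝ (fderiv ℝ s) z :=
    (hs'.fderiv_right (m := 1) (by norm_cast)).differentiableAt one_ne_zero
  have hΓ := h.differentiableAt_christoffel hz
  -- The second covariant derivative of the section, in the directions `x` and `v`.
  have key : ∀ x v, fderiv ℝ (fun y => fderiv ℝ s y v) z x +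
      (Γ z v (fderiv ℝ s z x) + fderiv ℝ Γ z x v (s z)) +
      Γ z x (fderiv ℝ s z v + Γ z v (s z)) ∈ W z := by
    intro x v
    have h1 := hW.parallel O hO hOΩ _ (hsmooth v) (hmem v) z hzO x
    have h2 := ((hasFDerivAt_apply hd2 v).differentiableAt.hasFDerivAt).add
      ((hasFDerivAt_apply hΓ v).clm_apply hds)
    rw [show fderiv ℝ (fun y => fderiv ℝ s y v + Γ y v (s y)) z = _ from h2.fderiv] at h1
    simpa using h1
  have h3 := sub_mem (key u a) (key a u)
  have hcomm := fderiv_fderiv_comm hO hs hzO u a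
  have e1 : Γ z u (Γ z a (s z)) = 0 := by
    rw [hsz, map_add, h.christoffel_eq_zero' hz hp ha, zero_add]
    exact h.christoffel_eq_zero hz hu (h.preserves₂ z hz _ _ hq)
  have e2 : Γ z a (Γ z u (s z)) = 0 := by
    rw [hsz, map_add, h.christoffel_eq_zero hz hu hq, add_zero]
    exact h.christoffel_eq_zero' hz (h.preserves₁ z hz _ _ hp) ha
  have e3 : fderiv ℝ Γ z u a (s z) = fderiv ℝ Γ z u a q := by
    rw [hsz, map_add, h.fderiv_christoffel_comm hz u a p, h.fderiv_christoffel_eq_zero hz u hp ha,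
      zero_add]
  have e4 : fderiv ℝ Γ z a u (s z) = fderiv ℝ Γ z a u p := by
    rw [hsz, map_add, h.fderiv_christoffel_eq_zero hz a hu hq, add_zero]
  rw [map_add (Γ z u), map_add (Γ z a), e1, e2, e3, e4, hcomm] at h3
  convert h3 using 1
  abel

/-- At a point where the mixed part of the Faraday form does not vanish, there are only four
possible values of a parallel distribution. -/
theorem eq_bot_or_eq_or_eq_or_eq_top (h : IsLocalAdaptedWeyl P Q Ω G Γ θ) {W : V → Submodule ℝ V}
    (hW : IsLocalParallel Ω Γ W) {z : V} (hz : z ∈ Ω)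
    (hF : ∃ u ∈ P, ∃ a ∈ Q, faraday θ z u a ≠ 0)
    (h2 : Module.finrank ℝ V ≠ 2) (h4 : Module.finrank ℝ V ≠ 4) :
    W z = ⊥ ∨ W z = P ∨ W z = Q ∨ W z = ⊤ := by
  choose b hbP hb using fun a => exists_dual_mem (h.pos z hz) P ((faraday θ z).flip a)
  choose b' hbQ hb' using fun u => exists_dual_mem (h.pos z hz) Q (faraday θ z u)
  have hinv : MixedCurvatureInvariant P Q (G z) (faraday θ z) b b' (W z) :=
    { symm := h.symm z hz
      pos := h.pos z hz
      mem_b := hbP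
      mem_b' := hbQ
      b_dual := fun a w hw => hb a w hw
      b'_dual := fun u c hc => hb' u c hc
      invariant := fun u hu a ha s hs t ht hst => by
        have h1 := h.curvature_mem hW hz hu ha hs ht hst
        have hskew : ∀ x y, faraday θ z x y = -faraday θ z y x := fun x y => by
          simp [faraday_apply]
        rw [h.fderiv_christoffel_eq hz ha hu hs (hbP a) (fun w hw => hb a w hw),
          h.swap.fderiv_christoffel_eq hz hu ha ht (neg_mem (hbQ u)) (fun w hw => by
            rw [map_neg, neg_apply, hb' u w hw, hskew w u]), hskew a u, hskew t u] at h1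
        convert sub_mem h1 ((W z).smul_mem (faraday θ z u a) hst) using 1
        module }
  exact hinv.eq_bot_or_eq_or_eq_or_eq_top hF h.isCompl h2 h4

end IsLocalAdaptedWeyl
/-! ### Closedness and unique continuation -/

omit [FiniteDimensional ℝ V] in
theorem exists_eventually_norm_apply₂_le {Γ : V → V →L[ℝ] V →L[ℝ] V} {z : V}
    (hΓ : ContinuousAt Γ z) :
    ∃ C, 0 ≤ C ∧ ∀ᶠ y in 𝓝 z, ∀ v x, ‖Γ y v x‖ ≤ C * ‖v‖ * ‖x‖ := by
  have hn : Continuous (norm : (V →L[ℝ] V →L[ℝ] V) → ℝ) :=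
    @continuous_norm _ ContinuousLinearMap.toSeminormedAddCommGroup.toSeminormedAddGroup
  refine ⟨‖Γ z‖ + 1, by positivity,
    ((hn.continuousAt.comp hΓ).eventually_lt_const (lt_add_one _)).mono fun y hy v x => ?_⟩
  have hy' : ‖Γ y‖ ≤ ‖Γ z‖ + 1 := hy.le
  refine ((Γ y).le_opNorm₂ v x).trans ?_
  gcongr

omit [FiniteDimensional ℝ V] in
/-- The coefficients with respect to a continuous family of linearly independent vectors are
locally uniformly bounded by the vector they represent. -/
theorem exists_eventually_norm_le_of_linearIndependent {X ι : Type*} [TopologicalSpace X]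
    [Fintype ι] {s : ι → X → V} {z₀ : X} (hs : ∀ i, ContinuousAt (s i) z₀)
    (hli : LinearIndependent ℝ fun i => s i z₀) :
    ∃ K : ℝ, 0 < K ∧ ∀ᶠ z in 𝓝 z₀, ∀ c : ι → ℝ, ‖c‖ ≤ K * ‖∑ i, c i • s i z‖ := by
  let S : X → (ι → ℝ) →L[ℝ] V := fun z =>
    ∑ i, (ContinuousLinearMap.proj i : (ι → ℝ) →L[ℝ] ℝ).smulRight (s i z)
  have hSapp : ∀ z c, S z c = ∑ i, c i • s i z := fun z c => by simp [S]
  have hScont : ContinuousAt S z₀ := by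
    refine tendsto_finsetSum _ fun i _ => ?_
    exact ((ContinuousLinearMap.smulRightL ℝ (ι → ℝ) V
      (ContinuousLinearMap.proj i)).continuous.tendsto _).comp (hs i)
  obtain ⟨K, hK, hanti⟩ := (S z₀).toLinearMap.exists_antilipschitzWith (by
    rw [LinearMap.ker_eq_bot']
    intro c hc
    have := Fintype.linearIndependent_iff.1 hli c (by simpa [hSapp] using hc)
    exact funext this)
  have hK' : (0 : ℝ) < K := hK
  refine ⟨2 * K, by positivity, ?_⟩
  have h1 : ∀ᶠ z in 𝓝 z₀, ‖S z - S z₀‖ < 1 / (2 * K) :=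
    (tendsto_iff_norm_sub_tendsto_zero.1 hScont).eventually_lt_const (by positivity)
  filter_upwards [h1] with z hz c
  rw [← hSapp]
  have h2 : ‖c‖ ≤ K * ‖S z₀ c‖ := by simpa using hanti.le_mul_dist c 0
  have h3 : ‖S z₀ c‖ ≤ ‖S z c‖ + 1 / (2 * K) * ‖c‖ := by
    have : S z₀ c = S z c - (S z - S z₀) c := by simp
    rw [this]
    refine (norm_sub_le _ _).trans ?_
    gcongr
    exact ((S z - S z₀).le_opNorm c).trans (by gcongr)
  have h5 : K * (‖S z c‖ + 1 / (2 * K) * ‖c‖) = K * ‖S z c‖ + ‖c‖ / 2 := by field_simp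
  have h6 : K * ‖S z₀ c‖ ≤ K * (‖S z c‖ + 1 / (2 * K) * ‖c‖) := by gcongr
  linarith

namespace IsLocalAdaptedWeyl

variable {P Q : Submodule ℝ V} {Ω : Set V} {G : V → V →L[ℝ] V →L[ℝ] ℝ}
    {Γ : V → V →L[ℝ] V →L[ℝ] V} {θ : V → V →L[ℝ] ℝ}

/-- Along `Q`, the Lee form is the differential of `-log (G e e) / 2` for each `e ∈ P`. -/
theorem faraday_eq_zero_of_mem (h : IsLocalAdaptedWeyl P Q Ω G Γ θ) {z : V} (hz : z ∈ Ω)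
    {a c : V} (ha : a ∈ Q) (hc : c ∈ Q) : faraday θ z a c = 0 := by
  obtain ⟨e, he, he0⟩ := Submodule.exists_mem_ne_zero_of_ne_bot h.ne_bot₁
  have hlog : ContDiffOn ℝ ∞ (fun y => Real.log (G y e e)) Ω :=
    (h.smooth_metric e e).log fun y hy => (h.pos y hy e he0).ne'
  have hfd : ∀ x ∈ Q, ∀ y ∈ Ω,
      θ y x = (-1 / 2 : ℝ) * fderiv ℝ (fun y => Real.log (G y e e)) y x := by
    intro x hx y hy
    have hd : DifferentiableAt ℝ (fun y => G y e e) y :=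
      ((h.smooth_metric e e).contDiffAt (h.isOpen.mem_nhds hy)).differentiableAt (by simp)
    have hp := (h.pos y hy e he0).ne'
    rw [fderiv.log hd hp, smul_apply, h.fderiv_metric hy hx he he, smul_eq_mul]
    field_simp
  have hfd2 : ∀ x ∈ Q, ∀ v, fderiv ℝ θ z v x =
      (-1 / 2 : ℝ) * fderiv ℝ (fun y => fderiv ℝ (fun y => Real.log (G y e e)) y x) z v := by
    intro x hx v
    have hd : DifferentiableAt ℝ (fun y => fderiv ℝ (fun y => Real.log (G y e e)) y x) z :=
      ((((hlog.fderiv_of_isOpen h.isOpen (m := ∞) (by simp)).clm_apply contDiffOn_const).contDiffAt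
        (h.isOpen.mem_nhds hz)).differentiableAt (by simp))
    have h1 : fderiv ℝ (fun y => θ y x) z v = fderiv ℝ θ z v x := by
      rw [(hasFDerivAt_apply (h.differentiableAt_lee hz) x).fderiv]; rfl
    rw [← h1, Filter.EventuallyEq.fderiv_eq (Filter.eventuallyEq_of_mem (h.isOpen.mem_nhds hz)
      (hfd x hx)), fderiv_const_mul hd]
    rfl
  rw [faraday_apply, hfd2 c hc, hfd2 a ha, fderiv_fderiv_comm h.isOpen hlog hz c a, sub_self]

theorem faraday_eq_zero (h : IsLocalAdaptedWeyl P Q Ω G Γ θ) {z : V} (hz : z ∈ Ω)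
    (hF : ∀ u ∈ P, ∀ a ∈ Q, faraday θ z u a = 0) : faraday θ z = 0 := by
  ext v w
  obtain ⟨p, hp, q, hq, rfl⟩ := Submodule.mem_sup.1
    (show v ∈ P ⊔ Q by rw [h.isCompl.sup_eq_top]; trivial)
  obtain ⟨p', hp', q', hq', rfl⟩ := Submodule.mem_sup.1
    (show w ∈ P ⊔ Q by rw [h.isCompl.sup_eq_top]; trivial)
  have h1 : faraday θ z q p' = 0 := by
    rw [← neg_eq_zero, ← hF p' hp' q hq]
    simp [faraday_apply]
  simp [h.faraday_eq_zero_of_mem hz hq hq', h.swap.faraday_eq_zero_of_mem hz hp hp',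
    hF p hp q' hq', h1]

/-- If the mixed part of the Faraday form vanishes, then the Lee form is locally exact by the
Poincaré lemma, and the metric has a local rescaling that is parallel. -/
theorem exists_conformal_factor (h : IsLocalAdaptedWeyl P Q Ω G Γ θ) {z₀ : V} (hz₀ : z₀ ∈ Ω)
    (hF : ∀ z ∈ Ω, ∀ u ∈ P, ∀ a ∈ Q, faraday θ z u a = 0) :
    ∃ N, IsOpen N ∧ z₀ ∈ N ∧ N ⊆ Ω ∧ ∃ f : V → ℝ, ContDiffOn ℝ ∞ f N ∧ (∀ z ∈ N, 0 < f z) ∧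
      ∀ z ∈ N, ∀ v, fderiv ℝ f z v = 2 * θ z v * f z := by
  obtain ⟨ε, hε, hball⟩ := Metric.isOpen_iff.1 h.isOpen z₀ hz₀
  have hθ := h.contDiffOn_lee.mono hball
  obtain ⟨k, hk⟩ := (convex_ball z₀ ε).exists_forall_hasFDerivAt_of_fderiv_symmetric
    Metric.isOpen_ball (hθ.differentiableOn (by simp)) fun a ha x y => by
      have := congrArg (fun L => L x y) (h.faraday_eq_zero (hball ha) (hF a (hball ha)))
      exact sub_eq_zero.1 this
  have hkd : ContDiffOn ℝ ∞ k (Metric.ball z₀ ε) := by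
    rw [contDiffOn_infty_iff_fderiv_of_isOpen Metric.isOpen_ball]
    exact ⟨fun x hx => (hk x hx).differentiableAt.differentiableWithinAt,
      hθ.congr fun x hx => (hk x hx).fderiv⟩
  refine ⟨Metric.ball z₀ ε, Metric.isOpen_ball, Metric.mem_ball_self hε, hball,
    fun z => Real.exp (2 * k z), (contDiffOn_const.mul hkd).exp, fun z _ => Real.exp_pos _,
    fun z hz v => ?_⟩
  rw [((hk z hz).const_mul 2).exp.fderiv]
  simp
  ring

omit [FiniteDimensional ℝ V] in
/-- The projection onto `Q` along `P` is parallel. -/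
theorem projection_christoffel (h : IsLocalAdaptedWeyl P Q Ω G Γ θ) {z : V} (hz : z ∈ Ω)
    (v x : V) :
    Q.projection P h.isCompl.symm (Γ z v x) = Γ z v (Q.projection P h.isCompl.symm x) := by
  obtain ⟨p, hp, q, hq, rfl⟩ := Submodule.mem_sup.1
    (show x ∈ P ⊔ Q by rw [h.isCompl.sup_eq_top]; trivial)
  simp only [map_add]
  rw [Submodule.projection_apply_of_mem_right _ (h.preserves₁ z hz v p hp),
    Submodule.projection_apply_of_mem_left _ (h.preserves₂ z hz v q hq),
    Submodule.projection_apply_of_mem_right _ hp,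
    Submodule.projection_apply_of_mem_left _ hq, map_zero]

/-- Unique continuation: whether a parallel distribution is contained in `P` does not change
within a neighbourhood. The `Q`-components of a local frame of the distribution solve
a homogeneous linear differential equation along line segments. -/
theorem exists_open_le_of_le (h : IsLocalAdaptedWeyl P Q Ω G Γ θ) {W : V → Submodule ℝ V}
    (hW : IsLocalParallel Ω Γ W) {z₀ : V} (hz₀ : z₀ ∈ Ω) :
    ∃ N, IsOpen N ∧ z₀ ∈ N ∧ N ⊆ Ω ∧ ∀ z ∈ N, ∀ z' ∈ N, W z ≤ P → W z' ≤ P := by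
  obtain ⟨O, hO, hzO, hOΩ, r, s, hs, hsW⟩ := hW.frame z₀ hz₀
  have hscont : ∀ i, ContinuousAt (s i) z₀ := fun i =>
    (hs i).continuousOn.continuousAt (hO.mem_nhds hzO)
  obtain ⟨K, hK, hcoef⟩ := exists_eventually_norm_le_of_linearIndependent hscont (hsW z₀ hzO).1
  -- The covariant derivative of the frame.
  let T : Fin r → V → V →L[ℝ] V := fun i y => fderiv ℝ (s i) y + (Γ y).flip (s i y)
  have hΓc : ContinuousAt Γ z₀ := (h.differentiableAt_christoffel hz₀).continuousAt
  have hTc : ∀ i, ContinuousAt (T i) z₀ := fun i => by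
    have h1 : ContinuousAt (fderiv ℝ (s i)) z₀ :=
      ((hs i).fderiv_of_isOpen hO (m := ∞) (by simp)).continuousOn.continuousAt (hO.mem_nhds hzO)
    have h2 : ContinuousAt (fun y => (Γ y).flip) z₀ :=
      (ContinuousLinearMap.flipₗᵢ ℝ V V V).continuous.continuousAt.comp hΓc
    exact h1.add (h2.clm_apply (hscont i))
  obtain ⟨B, hB0, hΓB⟩ := exists_eventually_norm_apply₂_le hΓc
  set C : ℝ := ∑ i, ‖T i z₀‖ + 1 with hC
  have hC0 : 0 ≤ C := by positivity
  have hTC : ∀ᶠ z in 𝓝 z₀, ∀ i, ‖T i z‖ < C := by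
    rw [Filter.eventually_all]
    intro i
    refine (hTc i).norm.eventually_lt_const ?_
    have := Finset.single_le_sum (f := fun i => ‖T i z₀‖) (fun i _ => norm_nonneg _)
      (Finset.mem_univ i)
    linarith
  obtain ⟨ε, hε, hball⟩ := Metric.eventually_nhds_iff_ball.1
    (((hcoef.and hTC).and hΓB).and (hO.mem_nhds hzO))
  refine ⟨Metric.ball z₀ ε, Metric.isOpen_ball, Metric.mem_ball_self hε,
    fun z hz => hOΩ (hball z hz).2, fun z hz z' hz' hzP => ?_⟩
  set v := z' - z with hv
  let pr : V →L[ℝ] V := LinearMap.toContinuousLinearMap (Q.projection P h.isCompl.symm)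
  have hpr0 : ∀ x, pr x = 0 ↔ x ∈ P := fun x =>
    Submodule.projection_apply_eq_zero_iff h.isCompl.symm
  have hprΓ : ∀ y ∈ Ω, ∀ v x, pr (Γ y v x) = Γ y v (pr x) := fun y hy v x =>
    h.projection_christoffel hy v x
  have hseg : ∀ t ∈ Icc (0 : ℝ) 1, z + t • v ∈ Metric.ball z₀ ε := fun t ht =>
    (convex_ball z₀ ε).add_smul_sub_mem hz hz' ht
  -- The `Q`-components of the frame along the segment from `z` to `z'`, and their derivatives.
  let w : ℝ → Fin r → V := fun t i => pr (s i (z + t • v))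
  let w' : ℝ → Fin r → V := fun t i => pr (fderiv ℝ (s i) (z + t • v) v)
  have hw : ∀ t ∈ Icc (0 : ℝ) 1, HasDerivAt w (w' t) t := by
    intro t ht
    rw [hasDerivAt_pi]
    intro i
    have hyO := (hball _ (hseg t ht)).2
    have h1 : HasFDerivAt (s i) (fderiv ℝ (s i) (z + t • v)) (z + t • v) :=
      (((hs i).contDiffAt (hO.mem_nhds hyO)).differentiableAt (by simp)).hasFDerivAt
    have h2 : HasDerivAt (fun t : ℝ => z + t • v) v t := by
      simpa using ((hasDerivAt_id t).smul_const v).const_add z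
    exact pr.hasFDerivAt.comp_hasDerivAt t (h1.comp_hasDerivAt t h2)
  have hw0 : w 0 = 0 := by
    ext1 i
    have : s i z ∈ W z := by
      rw [← (hsW z (hball z hz).2).2]
      exact Submodule.subset_span ⟨i, rfl⟩
    simpa [w] using (hpr0 _).2 (hzP this)
  have hbound : ∀ t ∈ Icc (0 : ℝ) 1,
      ‖w' t‖ ≤ (r * (K * (C * ‖v‖)) + B * ‖v‖) * ‖w t‖ := by
    intro t ht
    obtain ⟨⟨⟨hcy, hTy⟩, hΓy⟩, hyO⟩ := hball _ (hseg t ht)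
    set y := z + t • v with hy
    refine (pi_norm_le_iff_of_nonneg (by positivity)).2 fun i => ?_
    have hcov : T i y v ∈ W y := hW.parallel O hO hOΩ (s i) (hs i) (fun y hy => by
      rw [← (hsW y hy).2]
      exact Submodule.subset_span ⟨i, rfl⟩) y hyO v
    rw [← (hsW y hyO).2, Submodule.mem_span_range_iff_exists_fun] at hcov
    obtain ⟨c, hc⟩ := hcov
    have hcn : ‖c‖ ≤ K * (C * ‖v‖) := by
      refine (hcy c).trans ?_
      rw [hc]
      gcongr
      exact ((T i y).le_opNorm v).trans (by gcongr; exact (hTy i).le)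
    -- The linear differential equation: the frame is mapped to its own span by `T`, and the
    -- projection commutes with `Γ`.
    have e : w' t i = ∑ j, c j • w t j - Γ y v (w t i) := by
      have h1 : fderiv ℝ (s i) y v = ∑ j, c j • s j y - Γ y v (s i y) := by
        rw [hc]; simp [T]
      change pr (fderiv ℝ (s i) y v) = _
      rw [h1, map_sub, map_sum, hprΓ y (hOΩ hyO)]
      simp only [map_smul]
      rfl
    rw [e]
    have n1 : ‖∑ j, c j • w t j‖ ≤ r * (K * (C * ‖v‖)) * ‖w t‖ := by
      refine (norm_sum_le _ _).trans ?_
      have : ∀ j ∈ Finset.univ, ‖c j • w t j‖ ≤ K * (C * ‖v‖) * ‖w t‖ := fun j _ => by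
        rw [norm_smul]
        gcongr
        · exact (norm_le_pi_norm c j).trans hcn
        · exact norm_le_pi_norm (w t) j
      refine (Finset.sum_le_sum this).trans (le_of_eq ?_)
      simp
      ring
    have n2 : ‖Γ y v (w t i)‖ ≤ B * ‖v‖ * ‖w t‖ := by
      refine (hΓy v _).trans ?_
      gcongr
      exact norm_le_pi_norm (w t) i
    refine (norm_sub_le _ _).trans ?_
    linarith
  have hzero := eq_zero_of_abs_deriv_le_mul_abs_self_of_eq_zero_right
    (fun t ht => (hw t ht).continuousAt.continuousWithinAt)
    (fun t ht => (hw t (Ico_subset_Icc_self ht)).hasDerivWithinAt) hw0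
    (fun t ht => hbound t (Ico_subset_Icc_self ht)) 1 (right_mem_Icc.2 zero_le_one)
  rw [← (hsW z' (hball z' hz').2).2, Submodule.span_le]
  rintro _ ⟨i, rfl⟩
  have := congrFun hzero i
  simp only [w, one_smul, hv, add_sub_cancel, Pi.zero_apply] at this
  exact (hpr0 _).1 this

end IsLocalAdaptedWeyl
end Local

/-! ### Connections in a chart -/

section Chart

variable {E : Type*} [NormedAddCommGroup E] [NormedSpace ℝ E]
  {H : Type*} [TopologicalSpace H] (I : ModelWithCorners ℝ E H)
  {M : Type*} [TopologicalSpace M] [ChartedSpace H M] [IsManifold I ∞ M]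

/-- The coordinates of tangent vectors at `x` in the chart at `p`. Meaningful only if `x` is in the
source of this chart. -/
def toCoord (p x : M) : TangentSpace I x →L[ℝ] E :=
  (trivializationAt E (TangentSpace I) p).continuousLinearMapAt ℝ x

/-- The tangent vector at `x` with given coordinates in the chart at `p`. Meaningful only if `x` is
in the source of this chart. -/
def ofCoord (p x : M) : E →L[ℝ] TangentSpace I x :=
  (trivializationAt E (TangentSpace I) p).symmL ℝ x

variable {I}

theorem toCoord_ofCoord {p x : M} (hx : x ∈ (chartAt H p).source) (v : E) :
    toCoord I p x (ofCoord I p x v) = v :=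
  (trivializationAt E (TangentSpace I) p).continuousLinearMapAt_symmL (by simpa using hx) v

theorem ofCoord_toCoord {p x : M} (hx : x ∈ (chartAt H p).source) (v : TangentSpace I x) :
    ofCoord I p x (toCoord I p x v) = v :=
  (trivializationAt E (TangentSpace I) p).symmL_continuousLinearMapAt (by simpa using hx) v

theorem toCoord_eq_mfderiv {p x : M} (hx : x ∈ (chartAt H p).source) :
    toCoord I p x = mfderiv I 𝓘(ℝ, E) (extChartAt I p) x :=
  TangentBundle.continuousLinearMapAt_trivializationAt hx

theorem trivializationAt_apply_snd {p x : M} (hx : x ∈ (chartAt H p).source)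
    (v : TangentSpace I x) :
    ((trivializationAt E (TangentSpace I) p) ⟨x, v⟩).2 = toCoord I p x v := by
  rw [toCoord, Trivialization.continuousLinearMapAt_apply,
    Trivialization.linearMapAt_apply, if_pos (by simpa using hx)]

theorem contMDiffOn_section_iff_toCoord {p : M} {U : Set M} (hU : IsOpen U)
    (hUp : U ⊆ (chartAt H p).source) {s : (x : M) → TangentSpace I x} :
    CMDiff[U] ∞ (T% s) ↔ ContMDiffOn I 𝓘(ℝ, E) ∞ (fun x => toCoord I p x (s x)) U := by
  rw [(trivializationAt E (TangentSpace I) p).contMDiffOn_section_iff hU (by simpa using hUp)]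
  exact contMDiffOn_congr fun x hx => trivializationAt_apply_snd (hUp hx) (s x)

theorem mdifferentiableAt_section_iff_toCoord {p x : M} (hx : x ∈ (chartAt H p).source)
    {s : (x : M) → TangentSpace I x} :
    MDiffAt (T% s) x ↔ MDifferentiableAt I 𝓘(ℝ, E) (fun x => toCoord I p x (s x)) x := by
  rw [(trivializationAt E (TangentSpace I) p).mdifferentiableAt_section_iff I s (by simpa using hx)]
  refine Filter.EventuallyEq.mdifferentiableAt_iff ?_
  filter_upwards [(chartAt H p).open_source.mem_nhds hx] with y hy
  exact trivializationAt_apply_snd hy _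

variable [I.Boundaryless]

/-- The derivative of a function in a chart is its differential in coordinates. -/
theorem hasFDerivAt_comp_extChartAt_symm {F : Type*} [NormedAddCommGroup F] [NormedSpace ℝ F]
    {p x : M} (hx : x ∈ (chartAt H p).source) {h : M → F} (hh : MDifferentiableAt I 𝓘(ℝ, F) h x) :
    HasFDerivAt (h ∘ (extChartAt I p).symm) ((mvfderiv I h x).comp (ofCoord I p x))
      (extChartAt I p x) := by
  have hx' : x ∈ (extChartAt I p).source := by rwa [extChartAt_source]
  have hinv : (extChartAt I p).symm (extChartAt I p x) = x := (extChartAt I p).left_inv hx'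
  have h1 : HasMFDerivAt I 𝓘(ℝ, F) h ((extChartAt I p).symm (extChartAt I p x))
      (mfderiv I 𝓘(ℝ, F) h ((extChartAt I p).symm (extChartAt I p x))) := by
    rw [hinv]; exact hh.hasMFDerivAt
  have h2 : HasMFDerivAt 𝓘(ℝ, E) I (extChartAt I p).symm (extChartAt I p x)
      (mfderiv 𝓘(ℝ, E) I (extChartAt I p).symm (extChartAt I p x)) := by
    refine MDifferentiableAt.hasMFDerivAt ?_
    have := mdifferentiableWithinAt_extChartAt_symm ((extChartAt I p).map_source hx')
    rwa [I.range_eq_univ, mdifferentiableWithinAt_univ] at this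
  have h3 := (h1.comp _ h2).hasFDerivAt
  refine h3.congr_fderiv ?_
  have h4 := TangentBundle.symmL_trivializationAt (I := I) hx
  rw [I.range_eq_univ, mfderivWithin_univ] at h4
  ext v
  rw [ContinuousLinearMap.comp_apply, ofCoord, h4]
  have h5 : ∀ y, y = x → ∀ w : E,
      (mfderiv I 𝓘(ℝ, F) h y : E → F) w = (mfderiv I 𝓘(ℝ, F) h x : E → F) w := by
    rintro _ rfl w
    rfl
  exact h5 _ hinv _

theorem fderiv_comp_extChartAt_symm {F : Type*} [NormedAddCommGroup F] [NormedSpace ℝ F]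
    {p x : M} (hx : x ∈ (chartAt H p).source) {h : M → F} (hh : MDifferentiableAt I 𝓘(ℝ, F) h x)
    (v : E) :
    fderiv ℝ (h ∘ (extChartAt I p).symm) (extChartAt I p x) v =
      mvfderiv I h x (ofCoord I p x v) := by
  rw [(hasFDerivAt_comp_extChartAt_symm hx hh).fderiv]
  rfl

/-- The flat connection of the chart at `p`, which differentiates coordinates componentwise. -/
def flatDerivative (p : M) (s : (x : M) → TangentSpace I x) (x : M) :
    TangentSpace I x →L[ℝ] TangentSpace I x :=
  (ofCoord I p x).comp (mvfderiv I (fun y => toCoord I p y (s y)) x)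

omit [I.Boundaryless] in
theorem isCovariantDerivativeOn_flatDerivative (p : M) :
    IsCovariantDerivativeOn E (flatDerivative (I := I) p) (chartAt H p).source where
  add {s t x} hs ht hx := by
    have hs' := (mdifferentiableAt_section_iff_toCoord hx).1 hs
    have ht' := (mdifferentiableAt_section_iff_toCoord hx).1 ht
    have e : (fun y => toCoord I p y ((s + t) y)) =
        (fun y => toCoord I p y (s y)) + fun y => toCoord I p y (t y) := by
      ext y; simp
    rw [flatDerivative, e, mvfderiv_add hs' ht', ContinuousLinearMap.comp_add]
    rfl
  leibniz {s g x} hs hg hx := by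
    have hs' := (mdifferentiableAt_section_iff_toCoord hx).1 hs
    have e : (fun y => toCoord I p y ((g • s) y)) = g • fun y => toCoord I p y (s y) := by
      ext y; simp
    rw [flatDerivative, e, mvfderiv_smul hg hs']
    ext v
    simp [flatDerivative, ofCoord_toCoord hx]

section Christoffel

variable [FiniteDimensional ℝ E]
  (D : CovariantDerivative I E (TangentSpace I : M → Type _))

/-- The difference between `D` and the flat connection of the chart at `p`, at the point `x`, with
the direction as its first argument. -/
def christoffelAt (p x : M) : E →L[ℝ] E →L[ℝ] E :=
  let A : TangentSpace I x →L[ℝ] TangentSpace I x →L[ℝ] TangentSpace I x :=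
    (D.isCovariantDerivativeOn (s := (chartAt H p).source)).difference
      (isCovariantDerivativeOn_flatDerivative p) x
  (LinearMap.mk₂ ℝ (fun u v : E => toCoord I p x (A (ofCoord I p x v) (ofCoord I p x u)))
    (fun u u' v => by rw [map_add, map_add, map_add])
    (fun c u v => by rw [map_smul, map_smul, map_smul])
    (fun u v v' => by rw [map_add, map_add, add_apply, map_add])
    (fun c u v => by rw [map_smul, map_smul, smul_apply, map_smul])).toContinuousBilinearMap

/-- The Christoffel form of `D` in the chart at `p`, on the model space. -/
def christoffel (p : M) (z : E) : E →L[ℝ] E →L[ℝ] E :=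
  christoffelAt D p ((extChartAt I p).symm z)

/-- The coordinate formula for a covariant derivative. -/
theorem toCoord_covariantDerivative {p x : M} (hx : x ∈ (chartAt H p).source)
    {s : (x : M) → TangentSpace I x} (hs : MDiffAt (T% s) x) (u : E) :
    toCoord I p x (D s x (ofCoord I p x u)) =
      fderiv ℝ (fun z => toCoord I p ((extChartAt I p).symm z) (s ((extChartAt I p).symm z)))
        (extChartAt I p x) u + christoffel D p (extChartAt I p x) u (toCoord I p x (s x)) := by
  have hx' : x ∈ (extChartAt I p).source := by rwa [extChartAt_source]
  have hinv : (extChartAt I p).symm (extChartAt I p x) = x := (extChartAt I p).left_inv hx'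
  have h1 := fderiv_comp_extChartAt_symm hx ((mdifferentiableAt_section_iff_toCoord hx).1 hs) u
  have h2 : christoffel D p (extChartAt I p x) u (toCoord I p x (s x)) =
      toCoord I p x ((D.isCovariantDerivativeOn (s := (chartAt H p).source)).difference
      (isCovariantDerivativeOn_flatDerivative p) x (s x) (ofCoord I p x u)) := by
    rw [christoffel, hinv, christoffelAt, LinearMap.toContinuousBilinearMap_apply,
      LinearMap.mk₂_apply, ofCoord_toCoord hx]
  rw [h2, IsCovariantDerivativeOn.difference_apply _ _ hx hs]
  change _ = fderiv ℝ ((fun y => toCoord I p y (s y)) ∘ (extChartAt I p).symm) _ u + _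
  rw [h1]
  simp [flatDerivative, toCoord_ofCoord hx]

end Christoffel

end Chart

/-! ### Coordinate vector fields -/

section Chart

variable {E : Type*} [NormedAddCommGroup E] [NormedSpace ℝ E] [FiniteDimensional ℝ E]
  {H : Type*} [TopologicalSpace H] {I : ModelWithCorners ℝ E H} [I.Boundaryless]
  {M : Type*} [TopologicalSpace M] [ChartedSpace H M] [IsManifold I ∞ M]

omit [FiniteDimensional ℝ E] [I.Boundaryless] [IsManifold I ∞ M] in
theorem extChartAt_symm_mem_source {p : M} {z : E} (hz : z ∈ (extChartAt I p).target) :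
    (extChartAt I p).symm z ∈ (chartAt H p).source := by
  rw [← extChartAt_source I]
  exact (extChartAt I p).map_target hz

omit [FiniteDimensional ℝ E] [I.Boundaryless] in
/-- The coordinate representation of a smooth function is smooth. -/
theorem contDiffOn_comp_extChartAt_symm {F : Type*} [NormedAddCommGroup F] [NormedSpace ℝ F]
    {p : M} {U : Set M} {h : M → F} (hh : ContMDiffOn I 𝓘(ℝ, F) ∞ h U) :
    ContDiffOn ℝ ∞ (h ∘ (extChartAt I p).symm)
      ((extChartAt I p).target ∩ (extChartAt I p).symm ⁻¹' U) :=
  (hh.comp ((contMDiffOn_extChartAt_symm p).mono inter_subset_left)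
    fun _ hz => hz.2).contDiffOn

omit [FiniteDimensional ℝ E] [I.Boundaryless] in
theorem contMDiffOn_comp_extChartAt {F : Type*} [NormedAddCommGroup F] [NormedSpace ℝ F]
    {p : M} {O : Set E} {h : E → F} (hh : ContDiffOn ℝ ∞ h O) :
    ContMDiffOn I 𝓘(ℝ, F) ∞ (h ∘ extChartAt I p)
      ((chartAt H p).source ∩ extChartAt I p ⁻¹' O) :=
  hh.contMDiffOn.comp ((contMDiffOn_extChartAt (x := p)).mono inter_subset_left) fun _ hz => hz.2

omit [FiniteDimensional ℝ E] [I.Boundaryless] in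
/-- The coordinate vector fields of a chart are smooth. -/
theorem contMDiffOn_ofCoord (p : M) (v : E) :
    CMDiff[(chartAt H p).source] ∞ (T% (fun x : M => ofCoord I p x v)) := by
  rw [contMDiffOn_section_iff_toCoord (chartAt H p).open_source subset_rfl]
  exact contMDiffOn_const.congr fun x hx => toCoord_ofCoord hx v

omit [FiniteDimensional ℝ E] [I.Boundaryless] in
theorem mdifferentiableAt_ofCoord {p x : M} (hx : x ∈ (chartAt H p).source) (v : E) :
    MDiffAt (T% (fun x : M => ofCoord I p x v)) x :=
  ((contMDiffOn_ofCoord p v).contMDiffAt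
    ((chartAt H p).open_source.mem_nhds hx)).mdifferentiableAt (by simp)

/-! ### Metrics and Christoffel forms in coordinates -/

omit [FiniteDimensional ℝ E] [I.Boundaryless] in
theorem Metric.contMDiffOn (g : Metric I M) {U : Set M} {s t : (x : M) → TangentSpace I x}
    (hs : CMDiff[U] ∞ (T% s)) (ht : CMDiff[U] ∞ (T% t)) :
    ContMDiffOn I 𝓘(ℝ, ℝ) ∞ (fun x => g.inner x (s x) (t x)) U := by
  intro x hx
  have : ContMDiffWithinAt I (I.prod 𝓘(ℝ)) ∞
      (fun m ↦ TotalSpace.mk' ℝ (E := Bundle.Trivial M ℝ) m (g.inner m (s m) (t m))) U x :=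
    ContMDiffWithinAt.clm_bundle_apply₂ (F₁ := E) (F₂ := E)
      g.contMDiff.contMDiffAt.contMDiffWithinAt (hs x hx) (ht x hx)
  simp only [contMDiffWithinAt_totalSpace] at this
  exact this.2

omit [FiniteDimensional ℝ E] [I.Boundaryless] in
theorem Metric.mdifferentiableAt (g : Metric I M) {x : M} {s t : (x : M) → TangentSpace I x}
    (hs : MDiffAt (T% s) x) (ht : MDiffAt (T% t) x) :
    MDifferentiableAt I 𝓘(ℝ, ℝ) (fun x => g.inner x (s x) (t x)) x := by
  have : MDifferentiableAt I (I.prod 𝓘(ℝ))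
      (fun m ↦ TotalSpace.mk' ℝ (E := Bundle.Trivial M ℝ) m (g.inner m (s m) (t m))) x :=
    MDifferentiableAt.clm_bundle_apply₂ (F₁ := E) (F₂ := E)
      (g.contMDiff.mdifferentiableAt (by simp)) hs ht
  simp only [mdifferentiableAt_totalSpace] at this
  exact this.2

/-- The Gram form of a metric at the point `x`, in the chart at `p`. -/
def metricCoordAt (g : Metric I M) (p x : M) : E →L[ℝ] E →L[ℝ] ℝ :=
  (LinearMap.mk₂ ℝ (fun u v : E => g.inner x (ofCoord I p x u) (ofCoord I p x v))
    (fun u u' v => by rw [map_add, map_add, add_apply])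
    (fun c u v => by rw [map_smul, map_smul, smul_apply])
    (fun u v v' => by rw [map_add, map_add])
    (fun c u v => by rw [map_smul, map_smul])).toContinuousBilinearMap

/-- The Gram form of a metric in the chart at `p`, on the model space. -/
def metricCoord (g : Metric I M) (p : M) (z : E) : E →L[ℝ] E →L[ℝ] ℝ :=
  metricCoordAt g p ((extChartAt I p).symm z)

omit [I.Boundaryless] in
theorem contDiffOn_metricCoord (g : Metric I M) (p : M) (v w : E) :
    ContDiffOn ℝ ∞ (fun z => metricCoord g p z v w) (extChartAt I p).target := by
  refine (contDiffOn_comp_extChartAt_symm (p := p) (g.contMDiffOn (contMDiffOn_ofCoord p v)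
    (contMDiffOn_ofCoord p w))).mono ?_
  exact fun z hz => ⟨hz, extChartAt_symm_mem_source hz⟩

/-- A one-form in the chart at `p`, on the model space. -/
def leeCoord (θ : (x : M) → TangentSpace I x →L[ℝ] ℝ) (p : M) (z : E) : E →L[ℝ] ℝ :=
  (θ ((extChartAt I p).symm z)).comp (ofCoord I p _)

section Connection

variable (D : CovariantDerivative I E (TangentSpace I : M → Type _))

/-- The Christoffel form at `z` gives the covariant derivatives of the coordinate fields. -/
theorem covariantDerivative_ofCoord {p x : M} (hx : x ∈ (chartAt H p).source) (u v : E) :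
    D (fun x => ofCoord I p x v) x (ofCoord I p x u) =
      ofCoord I p x (christoffel D p (extChartAt I p x) u v) := by
  have h1 := toCoord_covariantDerivative D hx (mdifferentiableAt_ofCoord hx v) u
  have h2 : (fun z => toCoord I p ((extChartAt I p).symm z)
      (ofCoord I p ((extChartAt I p).symm z) v)) =ᶠ[𝓝 (extChartAt I p x)] fun _ => v := by
    have : (extChartAt I p).target ∈ 𝓝 (extChartAt I p x) :=
      (isOpen_extChartAt_target p).mem_nhds
        ((extChartAt I p).map_source (by rwa [extChartAt_source]))
    filter_upwards [this] with z hz using toCoord_ofCoord (extChartAt_symm_mem_source hz) v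
  rw [h2.fderiv_eq, toCoord_ofCoord hx] at h1
  simp only [fderiv_fun_const, Pi.zero_apply, zero_apply, zero_add] at h1
  rw [← h1, ofCoord_toCoord hx]

variable {D}

omit [I.Boundaryless] in
/-- The covariant derivative of a section that is smooth on an open set is smooth there. -/
theorem contMDiffOn_covariantDerivative [T2Space M]
    (hD : ContMDiffCovariantDerivativeOn E ∞ D.toFun Set.univ) {U : Set M} (hU : IsOpen U)
    {s t : (x : M) → TangentSpace I x} (hs : CMDiff[U] ∞ (T% s)) (ht : CMDiff[U] ∞ (T% t)) :
    CMDiff[U] ∞ (T% (fun x => D s x (t x))) := by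
  intro x hx
  -- Cut the section off outside of a neighbourhood of `x`.
  obtain ⟨ρ, -, hρ⟩ := (SmoothBumpFunction.nhds_basis_tsupport (I := I) x).mem_iff.1
    (hU.mem_nhds hx)
  have h1 : CMDiff ∞ (T% ((ρ : M → ℝ) • s)) :=
    ContMDiffOn.smul_section_of_tsupport ρ.contMDiff.contMDiffOn hU hρ hs
  have h2 := (hD.contMDiff (σ := (ρ : M → ℝ) • s) (by simpa using h1.contMDiffOn)).contMDiffAt
    (x := x) Filter.univ_mem
  have h3 : CMDiffAt ∞ (T% (fun x => D ((ρ : M → ℝ) • s) x (t x))) x :=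
    h2.clm_bundle_apply (F₁ := E) (F₂ := E) (ht.contMDiffAt (hU.mem_nhds hx))
  refine (h3.congr_of_eventuallyEq ?_).contMDiffWithinAt
  filter_upwards [ρ.eventuallyEq_one.eventually_nhds, hU.mem_nhds hx] with y hy hyU
  have hsy : MDiffAt (T% s) y := (hs.contMDiffAt (hU.mem_nhds hyU)).mdifferentiableAt (by simp)
  have : D s y = D ((ρ : M → ℝ) • s) y :=
    D.isCovariantDerivativeOnUniv.congr_of_eventuallyEq hsy
      (h1.contMDiffAt.mdifferentiableAt (by simp)) Filter.univ_mem
      (hy.mono fun w hw => by simp [hw])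
  simp [this]

theorem contDiffOn_christoffel [T2Space M]
    (hD : ContMDiffCovariantDerivativeOn E ∞ D.toFun Set.univ) (p : M) (u v : E) :
    ContDiffOn ℝ ∞ (fun z => christoffel D p z u v) (extChartAt I p).target := by
  have h1 := contMDiffOn_covariantDerivative hD (chartAt H p).open_source
    (contMDiffOn_ofCoord (I := I) p v) (contMDiffOn_ofCoord p u)
  rw [contMDiffOn_section_iff_toCoord (chartAt H p).open_source subset_rfl] at h1
  refine ((contDiffOn_comp_extChartAt_symm (p := p) h1).mono
    fun z hz => ⟨hz, extChartAt_symm_mem_source hz⟩).congr fun z hz => ?_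
  have hx := extChartAt_symm_mem_source hz
  simp only [Function.comp]
  rw [covariantDerivative_ofCoord D hx, toCoord_ofCoord hx, (extChartAt I p).right_inv hz]

omit [FiniteDimensional ℝ E] [I.Boundaryless] in
theorem mpullback_extChartAt_const {p x : M} (hx : x ∈ (chartAt H p).source) (v : E) :
    VectorField.mpullback I 𝓘(ℝ, E) (extChartAt I p) (fun _ => v) x = ofCoord I p x v := by
  have h1 := TangentBundle.continuousLinearMapAt_trivializationAt (I := I) hx
  have h2 : (mfderiv I 𝓘(ℝ, E) (extChartAt I p) x).IsInvertible :=
    isInvertible_mfderiv_extChartAt (by rwa [extChartAt_source])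
  change (mfderiv I 𝓘(ℝ, E) (extChartAt I p) x).inverse v = _
  have h3 : mfderiv I 𝓘(ℝ, E) (extChartAt I p) x (ofCoord I p x v) = v := by
    have := toCoord_ofCoord (I := I) hx v
    rw [toCoord, h1] at this
    exact this
  obtain ⟨e, he⟩ := h2
  rw [← he] at h3 ⊢
  rw [ContinuousLinearMap.inverse_equiv]
  exact (e.symm_apply_eq).2 h3.symm

omit [I.Boundaryless] in
/-- Coordinate vector fields commute. -/
theorem mlieBracket_ofCoord {p x : M} (hx : x ∈ (chartAt H p).source) (u v : E) :
    VectorField.mlieBracket I (fun x => ofCoord I p x u) (fun x => ofCoord I p x v) x = 0 := by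
  have h : ∀ v : E, (fun x : M => ofCoord I p x v) =ᶠ[𝓝 x]
      VectorField.mpullback I 𝓘(ℝ, E) (extChartAt I p) (fun _ => v) := fun v => by
    filter_upwards [(chartAt H p).open_source.mem_nhds hx] with y hy
    exact (mpullback_extChartAt_const hy v).symm
  have hc : ∀ v : E, MDifferentiableAt 𝓘(ℝ, E) 𝓘(ℝ, E).tangent
      (fun y : E => (⟨y, v⟩ : TangentBundle 𝓘(ℝ, E) E)) (extChartAt I p x) := fun v =>
    ((contMDiffAt_vectorSpace_iff_contDiffAt (n := ∞) (V := fun _ : E => v)).2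
      contDiffAt_const).mdifferentiableAt (by simp)
  have h2 : minSmoothness ℝ 2 ≤ (∞ : ℕ∞ω) := by
    simpa using (mod_cast le_top : ((2 : ℕ∞) : ℕ∞ω) ≤ ∞)
  have h3 : minSmoothness ℝ 3 ≤ (∞ : ℕ∞ω) := by
    simpa using (mod_cast le_top : ((3 : ℕ∞) : ℕ∞ω) ≤ ∞)
  have : IsManifold I (minSmoothness ℝ 2) M := IsManifold.of_le (n := ∞) h2
  have : IsManifold I (minSmoothness ℝ 3) M := IsManifold.of_le (n := ∞) h3
  have h0 (V W : (y : E) → TangentSpace 𝓘(ℝ, E) y) :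
      VectorField.mlieBracket 𝓘(ℝ, E) V W = VectorField.lieBracketWithin ℝ V W univ := by
    rw [← VectorField.mlieBracketWithin_univ, VectorField.mlieBracketWithin_eq_lieBracketWithin]
  have h1 : VectorField.lieBracketWithin ℝ (fun _ : E => u) (fun _ : E => v) univ
      (extChartAt I p x) = 0 := by
    simp [VectorField.lieBracketWithin]
  rw [(h u).mlieBracket_vectorField_eq (h v), ← VectorField.mpullback_mlieBracket (n := ∞) (hc u)
    (hc v) (contMDiffAt_extChartAt' hx) h2]
  change (mfderiv I 𝓘(ℝ, E) (extChartAt I p) x).inverse _ = _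
  refine (congrArg _ ((congrFun (h0 _ _) _).trans h1)).trans ?_
  exact map_zero _

theorem christoffel_comm (hD : D.torsion = 0) {p : M} {z : E} (hz : z ∈ (extChartAt I p).target)
    (u v : E) : christoffel D p z u v = christoffel D p z v u := by
  have hx := extChartAt_symm_mem_source hz
  have h1 := CovariantDerivative.torsion_eq_zero_iff D |>.1 hD (mdifferentiableAt_ofCoord hx u)
    (mdifferentiableAt_ofCoord hx v)
  rw [mlieBracket_ofCoord hx, covariantDerivative_ofCoord D hx, covariantDerivative_ofCoord D hx,
    (extChartAt I p).right_inv hz, sub_eq_zero] at h1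
  have := congrArg (toCoord I p _) h1
  rwa [toCoord_ofCoord hx, toCoord_ofCoord hx] at this

/-- The defining equation of the Lee form in coordinates. -/
theorem fderiv_metricCoord {g : Metric I M} {θ : (x : M) → TangentSpace I x →L[ℝ] ℝ}
    (hθ : IsLeeForm D g θ) {p : M} {z : E} (hz : z ∈ (extChartAt I p).target) (u v w : E) :
    fderiv ℝ (fun y => metricCoord g p y v w) z u =
      -2 * leeCoord θ p z u * metricCoord g p z v w +
        metricCoord g p z (christoffel D p z u v) w +
        metricCoord g p z v (christoffel D p z u w) := by
  have hx := extChartAt_symm_mem_source hz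
  have hv := mdifferentiableAt_ofCoord (I := I) hx v
  have hw := mdifferentiableAt_ofCoord (I := I) hx w
  have h1 := hθ _ _ _ hv hw (ofCoord I p _ u)
  have h2 := fderiv_comp_extChartAt_symm hx (g.mdifferentiableAt hv hw) u
  rw [(extChartAt I p).right_inv hz] at h2
  rw [covDerivBilin, ← h2, covariantDerivative_ofCoord D hx, covariantDerivative_ofCoord D hx,
    (extChartAt I p).right_inv hz] at h1
  change fderiv ℝ (fun y => metricCoord g p y v w) z u - metricCoord g p z _ w -
    metricCoord g p z v _ = -2 * leeCoord θ p z u * metricCoord g p z v w at h1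
  linarith

/-- If a parallel family is constant in a chart, then it is preserved by the Christoffel form. -/
theorem christoffel_mem {Δ : TangentSubspaces I M} (hΔ : IsParallelDistribution D Δ) {p : M}
    {P : Submodule ℝ E} (hP : ∀ x ∈ (chartAt H p).source, ∀ v, ofCoord I p x v ∈ Δ x ↔ v ∈ P)
    {z : E} (hz : z ∈ (extChartAt I p).target) (u : E) {v : E} (hv : v ∈ P) :
    christoffel D p z u v ∈ P := by
  have hx := extChartAt_symm_mem_source hz
  have := hΔ _ (chartAt H p).open_source _ (contMDiffOn_ofCoord p v)
    (fun y hy => (hP y hy v).2 hv) _ hx (ofCoord I p _ u)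
  rwa [covariantDerivative_ofCoord D hx, hP _ hx, (extChartAt I p).right_inv hz] at this

end Connection

end Chart

section Global

variable {E : Type*} [NormedAddCommGroup E] [NormedSpace ℝ E] [FiniteDimensional ℝ E]
  {H : Type*} [TopologicalSpace H] {I : ModelWithCorners ℝ E H} [I.Boundaryless]
  {M : Type*} [TopologicalSpace M] [ChartedSpace H M] [IsManifold I ∞ M]

/-! ### Distributions in a chart -/

/-- A family of tangent subspaces, read in the chart at `p` as a family of subspaces of the model
space. -/
def coordSubspaces (Δ : TangentSubspaces I M) (p : M) (z : E) : Submodule ℝ E :=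
  (Δ ((extChartAt I p).symm z)).comap (ofCoord I p ((extChartAt I p).symm z)).toLinearMap

omit [FiniteDimensional ℝ E] [I.Boundaryless] in
theorem mem_coordSubspaces {Δ : TangentSubspaces I M} {p : M} {z v : E} :
    v ∈ coordSubspaces Δ p z ↔
      ofCoord I p ((extChartAt I p).symm z) v ∈ Δ ((extChartAt I p).symm z) := Iff.rfl

/-- The family `Δ` is the constant family `P` in each of the preferred charts. -/
def IsModelledOn (P : Submodule ℝ E) (Δ : TangentSubspaces I M) : Prop :=
  ∀ p : M, ∀ x ∈ (chartAt H p).source, ∀ v, ofCoord I p x v ∈ Δ x ↔ v ∈ P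

omit [FiniteDimensional ℝ E] [I.Boundaryless] in
/-- To prove a property of all tangent vectors, argue in coordinates. -/
theorem forall_ofCoord {p x : M} (hx : x ∈ (chartAt H p).source) {q : TangentSpace I x → Prop}
    (h : ∀ v, q (ofCoord I p x v)) (w : TangentSpace I x) : q w :=
  ofCoord_toCoord hx w ▸ h (toCoord I p x w)

omit [FiniteDimensional ℝ E] [I.Boundaryless] in
theorem coordSubspaces_le_iff {Δ Δ' : TangentSubspaces I M} {p : M} {z : E}
    (hz : z ∈ (extChartAt I p).target) :
    coordSubspaces Δ p z ≤ coordSubspaces Δ' p z ↔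
      Δ ((extChartAt I p).symm z) ≤ Δ' ((extChartAt I p).symm z) :=
  ⟨fun h _ => forall_ofCoord (extChartAt_symm_mem_source hz)
    (q := fun w => w ∈ Δ _ → w ∈ Δ' _) (fun _ hv => h hv) _, fun h _ hv => h hv⟩

omit [FiniteDimensional ℝ E] [I.Boundaryless] in
theorem coordSubspaces_eq_iff {Δ Δ' : TangentSubspaces I M} {p : M} {z : E}
    (hz : z ∈ (extChartAt I p).target) :
    coordSubspaces Δ p z = coordSubspaces Δ' p z ↔
      Δ ((extChartAt I p).symm z) = Δ' ((extChartAt I p).symm z) := by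
  rw [le_antisymm_iff, le_antisymm_iff, coordSubspaces_le_iff hz, coordSubspaces_le_iff hz]

omit [FiniteDimensional ℝ E] [I.Boundaryless] in
theorem IsModelledOn.coordSubspaces_eq {P : Submodule ℝ E} {Δ : TangentSubspaces I M}
    (h : IsModelledOn P Δ) {p : M} {z : E} (hz : z ∈ (extChartAt I p).target) :
    coordSubspaces Δ p z = P :=
  Submodule.ext fun v => h p _ (extChartAt_symm_mem_source hz) v

omit [FiniteDimensional ℝ E] [I.Boundaryless] in
theorem ofCoord_injective {p x : M} (hx : x ∈ (chartAt H p).source) :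
    Function.Injective (ofCoord I p x) :=
  Function.LeftInverse.injective (toCoord_ofCoord hx)

omit [FiniteDimensional ℝ E] [I.Boundaryless] in
theorem toCoord_injective {p x : M} (hx : x ∈ (chartAt H p).source) :
    Function.Injective (toCoord I p x) :=
  Function.LeftInverse.injective (ofCoord_toCoord hx)

omit [I.Boundaryless] in
/-- A basis of `P` gives coordinate fields that form a frame. -/
theorem IsModelledOn.isSmoothDistribution {P : Submodule ℝ E} {Δ : TangentSubspaces I M}
    (h : IsModelledOn P Δ) : IsSmoothDistribution Δ := by
  intro p
  let b := Module.finBasis ℝ P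
  refine ⟨(chartAt H p).source, (chartAt H p).open_source, mem_chart_source H p, _,
    fun i x => ofCoord I p x (b i), fun i => contMDiffOn_ofCoord p _, fun y hy => ⟨?_, ?_⟩⟩
  · exact (b.linearIndependent.map' P.subtype P.ker_subtype).map'
      (ofCoord I p y).toLinearMap (LinearMap.ker_eq_bot.2 (ofCoord_injective hy))
  · have h1 : Submodule.span ℝ (range fun i => (b i : E)) = P := by
      have := congrArg (Submodule.map P.subtype) b.span_eq
      rw [Submodule.map_span, Submodule.map_top, Submodule.range_subtype, ← range_comp] at this
      exact this
    have h2 : (range fun i => ofCoord I p y (b i)) =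
        (ofCoord I p y).toLinearMap '' range fun i => (b i : E) := by
      rw [← range_comp]; rfl
    rw [h2, ← Submodule.map_span, h1]
    ext w
    refine forall_ofCoord hy (q := fun w => w ∈ Submodule.map _ P ↔ w ∈ Δ y) (fun v => ?_) w
    rw [h p y hy]
    exact (ofCoord_injective hy).mem_set_image

omit [FiniteDimensional ℝ E] [I.Boundaryless] in
/-- A proper nonzero constant family is neither `⊥` nor `⊤`. -/
theorem IsModelledOn.ne_bot_and_ne_top [Nonempty M] {P Q : Submodule ℝ E} (hPQ : IsCompl P Q)
    (hP : P ≠ ⊥) (hQ : Q ≠ ⊥) {Δ : TangentSubspaces I M} (h : IsModelledOn P Δ) :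
    Δ ≠ ⊥ ∧ Δ ≠ ⊤ := by
  obtain ⟨p⟩ := ‹Nonempty M›
  have hp := mem_chart_source H p
  constructor
  · rintro rfl
    refine hP ((Submodule.eq_bot_iff _).2 fun v hv => ofCoord_injective (I := I) hp ?_)
    exact ((h p p hp v).2 hv : ofCoord I p p v = 0).trans (map_zero _).symm
  · rintro rfl
    have hP' : P = ⊤ := Submodule.eq_top_iff'.2 fun v => (h p p hp v).1 trivial
    exact hQ (by simpa [hP'] using hPQ.inf_eq_bot)

omit [FiniteDimensional ℝ E] [I.Boundaryless] [IsManifold I ∞ M] in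
theorem isOpen_source_inter (p : M) {O : Set E} (hO : IsOpen O) :
    IsOpen ((chartAt H p).source ∩ extChartAt I p ⁻¹' O) := by
  rw [← extChartAt_source I]
  exact (continuousOn_extChartAt p).isOpen_inter_preimage (isOpen_extChartAt_source p) hO

/-- The coordinate representation of a parallel distribution is a parallel distribution. -/
theorem IsParallelDistribution.isLocalParallel
    {D : CovariantDerivative I E (TangentSpace I : M → Type _)} {Δ : TangentSubspaces I M}
    (hΔ : IsParallelDistribution D Δ) (hs : IsSmoothDistribution Δ) (p : M) :
    IsLocalParallel (extChartAt I p).target (christoffel D p) (coordSubspaces Δ p) where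
  frame z hz := by
    obtain ⟨U, hU, hzU, r, s, hs, hspan⟩ := hs ((extChartAt I p).symm z)
    refine ⟨(extChartAt I p).target ∩ (extChartAt I p).symm ⁻¹'
        ((chartAt H p).source ∩ U), ?_, ⟨hz, extChartAt_symm_mem_source hz, hzU⟩, inter_subset_left,
        r, fun i y => toCoord I p _ (s i ((extChartAt I p).symm y)), fun i => ?_, fun y hy => ?_⟩
    · exact (continuousOn_extChartAt_symm p).isOpen_inter_preimage (isOpen_extChartAt_target p)
        ((chartAt H p).open_source.inter hU)
    · exact contDiffOn_comp_extChartAt_symm ((contMDiffOn_section_iff_toCoord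
        ((chartAt H p).open_source.inter hU) inter_subset_left).1 ((hs i).mono inter_subset_right))
    · obtain ⟨hy, hy', hyU⟩ := hy
      obtain ⟨h1, h2⟩ := hspan _ hyU
      refine ⟨h1.map' (toCoord I p _).toLinearMap (LinearMap.ker_eq_bot.2 (toCoord_injective hy')),
        ?_⟩
      have h3 : (range fun i => toCoord I p _ (s i ((extChartAt I p).symm y))) =
          (toCoord I p ((extChartAt I p).symm y)).toLinearMap ''
            range fun i => s i ((extChartAt I p).symm y) := by
        rw [← range_comp]; rfl
      rw [h3, ← Submodule.map_span, h2]
      ext v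
      rw [mem_coordSubspaces]
      constructor
      · rintro ⟨w, hw, rfl⟩
        exact (ofCoord_toCoord hy' w).symm ▸ hw
      · exact fun hv => ⟨_, hv, toCoord_ofCoord hy' v⟩
  parallel O hO hOΩ s hs hsW y hy v := by
    have hys := extChartAt_symm_mem_source (hOΩ hy)
    have hright := (extChartAt I p).right_inv (hOΩ hy)
    have hU := isOpen_source_inter (I := I) p hO
    have hyU : (extChartAt I p).symm y ∈ (chartAt H p).source ∩ extChartAt I p ⁻¹' O :=
      ⟨hys, by rwa [mem_preimage, hright]⟩
    let S : (x : M) → TangentSpace I x := fun x => ofCoord I p x (s (extChartAt I p x))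
    have hS : CMDiff[(chartAt H p).source ∩ extChartAt I p ⁻¹' O] ∞ (T% S) := by
      rw [contMDiffOn_section_iff_toCoord hU inter_subset_left]
      exact (contMDiffOn_comp_extChartAt hs).congr fun x hx => toCoord_ofCoord hx.1 _
    have hmem : ∀ x ∈ (chartAt H p).source ∩ extChartAt I p ⁻¹' O, S x ∈ Δ x := by
      intro x hx
      have h1 := mem_coordSubspaces.1 (hsW _ hx.2)
      rwa [(extChartAt I p).left_inv (by rw [extChartAt_source]; exact hx.1)] at h1
    have h1 := hΔ _ hU S hS hmem _ hyU (ofCoord I p _ v)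
    have h2 := toCoord_covariantDerivative D hys
      ((hS.contMDiffAt (hU.mem_nhds hyU)).mdifferentiableAt (by simp)) v
    have h3 : (fun z => toCoord I p ((extChartAt I p).symm z) (S ((extChartAt I p).symm z)))
        =ᶠ[𝓝 y] s := by
      filter_upwards [hO.mem_nhds hy] with z hz
      rw [toCoord_ofCoord (extChartAt_symm_mem_source (hOΩ hz)),
        (extChartAt I p).right_inv (hOΩ hz)]
    rw [hright, h3.fderiv_eq, toCoord_ofCoord hys, hright] at h2
    rw [mem_coordSubspaces, ← h2, ofCoord_toCoord hys]
    exact h1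

/-! ### The local data of an adapted Weyl structure -/

/-- In a chart, a Weyl structure preserving two complementary families that are constant in all
charts is an adapted Weyl structure. -/
theorem isLocalAdaptedWeyl [T2Space M] {D : CovariantDerivative I E (TangentSpace I : M → Type _)}
    {c : ConformalStructure I M} (hD : IsWeylStructure c D) {g : Metric I M}
    {θ : (x : M) → TangentSpace I x →L[ℝ] ℝ} (hθ : IsLeeForm D g θ)
    {P Q : Submodule ℝ E} (hPQ : IsCompl P Q) (hP : P ≠ ⊥) (hQ : Q ≠ ⊥)
    {Δ₁ Δ₂ : TangentSubspaces I M} (h₁ : IsModelledOn P Δ₁) (h₂ : IsModelledOn Q Δ₂)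
    (hΔ₁ : IsParallelDistribution D Δ₁) (hΔ₂ : IsParallelDistribution D Δ₂) (p : M) :
    IsLocalAdaptedWeyl P Q (extChartAt I p).target (metricCoord g p) (christoffel D p)
      (leeCoord θ p) where
  isOpen := isOpen_extChartAt_target p
  isCompl := hPQ
  ne_bot₁ := hP
  ne_bot₂ := hQ
  smooth_metric := contDiffOn_metricCoord g p
  symm _ _ _ _ := g.symm _ _ _
  pos _ hz _ hv := g.pos _ _
    fun h => hv (ofCoord_injective (extChartAt_symm_mem_source hz) (h.trans (map_zero _).symm))
  smooth_christoffel := contDiffOn_christoffel hD.smooth p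
  torsion_free _ hz := christoffel_comm hD.torsion_free hz
  preserves₁ _ hz u _ hv := christoffel_mem hΔ₁ (h₁ p) hz u hv
  preserves₂ _ hz u _ hv := christoffel_mem hΔ₂ (h₂ p) hz u hv
  metric _ hz := fderiv_metricCoord hθ hz

omit [FiniteDimensional ℝ E] in
/-- A Weyl structure whose Lee form has a positive local solution of `df = 2 f θ` in each chart is
closed: such an `f` makes `f g` parallel. -/
theorem isClosedWeyl_of_conformal_factor
    {D : CovariantDerivative I E (TangentSpace I : M → Type _)}
    {c : ConformalStructure I M} {g : Metric I M} (hg : c.Contains g)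
    {θ : (x : M) → TangentSpace I x →L[ℝ] ℝ} (hθ : IsLeeForm D g θ)
    (h : ∀ p : M, ∃ N, IsOpen N ∧ extChartAt I p p ∈ N ∧ N ⊆ (extChartAt I p).target ∧
      ∃ f : E → ℝ, ContDiffOn ℝ ∞ f N ∧ (∀ z ∈ N, 0 < f z) ∧
        ∀ z ∈ N, ∀ v, fderiv ℝ f z v = 2 * leeCoord θ p z v * f z) :
    IsClosedWeyl c D := by
  intro p
  obtain ⟨N, hN, hpN, hNt, f, hf, hpos, hdf⟩ := h p
  have hU := isOpen_source_inter (I := I) p hN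
  have hsm : ContMDiffOn I 𝓘(ℝ, ℝ) ∞ (f ∘ extChartAt I p)
      ((chartAt H p).source ∩ extChartAt I p ⁻¹' N) := contMDiffOn_comp_extChartAt hf
  refine ⟨_, hU, ⟨mem_chart_source H p, hpN⟩, g, f ∘ extChartAt I p, hg,
    hsm, fun y hy => hpos _ hy.2, fun Y Z y hy hY hZ => ?_⟩
  have hleft : (extChartAt I p).symm (extChartAt I p y) = y :=
    (extChartAt I p).left_inv (by rw [extChartAt_source]; exact hy.1)
  have hfy : MDifferentiableAt I 𝓘(ℝ, ℝ) (f ∘ extChartAt I p) y :=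
    (hsm.contMDiffAt (hU.mem_nhds hy)).mdifferentiableAt (by simp)
  have hdf' : ∀ X : TangentSpace I y, mvfderiv I (f ∘ extChartAt I p) y X =
      2 * θ y X * f (extChartAt I p y) := by
    refine forall_ofCoord hy.1 fun v => ?_
    rw [← fderiv_comp_extChartAt_symm hy.1 hfy]
    have h1 : (f ∘ extChartAt I p) ∘ (extChartAt I p).symm =ᶠ[𝓝 (extChartAt I p y)] f := by
      filter_upwards [hN.mem_nhds hy.2] with z hz
      exact congrArg f ((extChartAt I p).right_inv (hNt hz))
    rw [h1.fderiv_eq, hdf _ hy.2]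
    have h2 : ∀ x, x = y → leeCoord θ p (extChartAt I p y) v = θ y (ofCoord I p y v) := by
      intro x hx
      simp only [leeCoord]
      rw [hleft]
      rfl
    rw [h2 _ hleft]
  intro X
  have h1 := hθ Y Z y hY hZ X
  have h2 := mvfderiv_mul hfy (g.mdifferentiableAt hY hZ)
  simp only [covDerivBilin] at h1 ⊢
  have h3 : (fun x => ((f ∘ extChartAt I p) x • g.inner x) (Y x) (Z x)) =
      (f ∘ extChartAt I p) * fun x => g.inner x (Y x) (Z x) := rfl
  rw [h3, h2]
  simp only [add_apply, smul_apply, smul_eq_mul, hdf' X]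
  simp only [Function.comp]
  linear_combination f (extChartAt I p y) * h1

/-! ### Propagation -/

omit [FiniteDimensional ℝ E] [I.Boundaryless] in
theorem IsSmoothDistribution.exists_open_finrank_eq {Δ : TangentSubspaces I M}
    (h : IsSmoothDistribution Δ) (x : M) :
    ∃ U, IsOpen U ∧ x ∈ U ∧ ∀ y ∈ U, Module.finrank ℝ (Δ y) = Module.finrank ℝ (Δ x) := by
  obtain ⟨U, hU, hx, r, s, -, hs⟩ := h x
  have h1 : ∀ y ∈ U, Module.finrank ℝ (Δ y) = r := fun y hy => by
    rw [← (hs y hy).2, finrank_span_eq_card (hs y hy).1, Fintype.card_fin]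
  exact ⟨U, hU, hx, fun y hy => by rw [h1 y hy, h1 x hx]⟩

omit [FiniteDimensional ℝ E] [I.Boundaryless] in
/-- The rank of a distribution on a connected manifold is constant. -/
theorem IsSmoothDistribution.finrank_eq [PreconnectedSpace M] {Δ : TangentSubspaces I M}
    (h : IsSmoothDistribution Δ) (x y : M) :
    Module.finrank ℝ (Δ x) = Module.finrank ℝ (Δ y) :=
  ((IsLocallyConstant.iff_exists_open _).2 h.exists_open_finrank_eq).apply_eq_of_preconnectedSpace
    x y

omit [FiniteDimensional ℝ E] [I.Boundaryless] in
/-- Containment between two families propagates over a connected manifold if it does so within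
neighbourhoods. -/
theorem le_of_exists_open [PreconnectedSpace M] {Δ Δ' : TangentSubspaces I M}
    (h : ∀ p : M, ∃ N, IsOpen N ∧ extChartAt I p p ∈ N ∧ N ⊆ (extChartAt I p).target ∧
      ∀ z ∈ N, ∀ z' ∈ N, coordSubspaces Δ p z ≤ coordSubspaces Δ' p z →
        coordSubspaces Δ p z' ≤ coordSubspaces Δ' p z')
    {x₀ : M} (hx₀ : Δ x₀ ≤ Δ' x₀) (x : M) : Δ x ≤ Δ' x := by
  have h1 : IsLocallyConstant fun x => Δ x ≤ Δ' x := by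
    refine (IsLocallyConstant.iff_exists_open _).2 fun p => ?_
    obtain ⟨N, hN, hpN, hNt, hle⟩ := h p
    refine ⟨_, isOpen_source_inter (I := I) p hN, ⟨mem_chart_source H p, hpN⟩, fun y hy => ?_⟩
    have h2 : ∀ x ∈ (chartAt H p).source ∩ extChartAt I p ⁻¹' N,
        (coordSubspaces Δ p (extChartAt I p x) ≤ coordSubspaces Δ' p (extChartAt I p x) ↔
          Δ x ≤ Δ' x) := fun x hx => by
      rw [coordSubspaces_le_iff (hNt hx.2),
        (extChartAt I p).left_inv (by rw [extChartAt_source]; exact hx.1)]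
    have h3 : p ∈ (chartAt H p).source ∩ extChartAt I p ⁻¹' N := ⟨mem_chart_source H p, hpN⟩
    exact propext ⟨fun hle' => (h2 p h3).1 (hle _ hy.2 _ hpN ((h2 y hy).2 hle')),
      fun hle' => (h2 y hy).1 (hle _ hpN _ hy.2 ((h2 p h3).2 hle'))⟩
  exact (h1.apply_eq_of_preconnectedSpace x₀ x).mp hx₀

/-- The parallel distributions of a non-closed Weyl structure that preserves two complementary
families, each constant in all charts. -/
theorem eq_bot_or_eq_or_eq_or_eq_top_of_not_isClosedWeyl [T2Space M] [ConnectedSpace M]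
    {D : CovariantDerivative I E (TangentSpace I : M → Type _)}
    {c : ConformalStructure I M} (hD : IsWeylStructure c D) (hnc : ¬ IsClosedWeyl c D)
    {P Q : Submodule ℝ E} (hPQ : IsCompl P Q) (hP : P ≠ ⊥) (hQ : Q ≠ ⊥)
    {Δ₁ Δ₂ : TangentSubspaces I M} (h₁ : IsModelledOn P Δ₁) (h₂ : IsModelledOn Q Δ₂)
    (hΔ₁ : IsParallelDistribution D Δ₁) (hΔ₂ : IsParallelDistribution D Δ₂)
    (hn2 : Module.finrank ℝ E ≠ 2) (hn4 : Module.finrank ℝ E ≠ 4)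
    {Δ : TangentSubspaces I M} (hs : IsSmoothDistribution Δ) (hΔ : IsParallelDistribution D Δ) :
    Δ = ⊥ ∨ Δ = Δ₁ ∨ Δ = Δ₂ ∨ Δ = ⊤ := by
  obtain ⟨g, hg⟩ := Quotient.exists_rep c
  obtain ⟨θ, hθ⟩ := hD.preserves g hg
  have hloc := isLocalAdaptedWeyl hD hθ hPQ hP hQ h₁ h₂ hΔ₁ hΔ₂
  have hmem : ∀ p : M, extChartAt I p p ∈ (extChartAt I p).target := mem_extChartAt_target
  obtain ⟨p, z, hz, hF⟩ : ∃ p : M, ∃ z ∈ (extChartAt I p).target,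
      ∃ u ∈ P, ∃ a ∈ Q, faraday (leeCoord θ p) z u a ≠ 0 := by
    by_contra! hF
    exact hnc (isClosedWeyl_of_conformal_factor hg hθ fun p =>
      (hloc p).exists_conformal_factor (hmem p) (hF p))
  have hpar := hΔ.isLocalParallel hs
  have (x : M) : FiniteDimensional ℝ (TangentSpace I x) := inferInstanceAs (FiniteDimensional ℝ E)
  -- Distributions that coincide at one point are equal if one is contained in the other.
  have hrank {Δ' Δ'' : TangentSubspaces I M} (x₀ : M) (h' : IsSmoothDistribution Δ')
      (h'' : IsSmoothDistribution Δ'') (hle : ∀ x, Δ' x ≤ Δ'' x) (h0 : Δ' x₀ = Δ'' x₀) :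
      Δ' = Δ'' :=
    funext fun x => Submodule.eq_of_le_of_finrank_eq (hle x) <| by
      rw [h'.finrank_eq x x₀, h''.finrank_eq x x₀, h0]
  have hbot : IsModelledOn ⊥ (⊥ : TangentSubspaces I M) := fun p x hx v => by
    change ofCoord I p x v = 0 ↔ v = 0
    exact map_eq_zero_iff _ (ofCoord_injective hx)
  have htop : IsModelledOn ⊤ (⊤ : TangentSubspaces I M) := fun p x hx v =>
    ⟨fun _ => trivial, fun _ => trivial⟩
  have hx : ∀ {P' : Submodule ℝ E} {Δ' : TangentSubspaces I M}, IsModelledOn P' Δ' →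
      coordSubspaces Δ p z = P' →
      Δ ((extChartAt I p).symm z) = Δ' ((extChartAt I p).symm z) := fun h' h =>
    (coordSubspaces_eq_iff hz).1 (h.trans (h'.coordSubspaces_eq hz).symm)
  rcases (hloc p).eq_bot_or_eq_or_eq_or_eq_top (hpar p) hz hF hn2 hn4 with h | h | h | h
  · refine Or.inl (hrank _ hbot.isSmoothDistribution hs (fun x => bot_le) (hx hbot h).symm).symm
  · refine Or.inr (Or.inl (hrank _ hs h₁.isSmoothDistribution
      (le_of_exists_open (fun q => ?_) (hx h₁ h).le) (hx h₁ h)))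
    obtain ⟨N, hN, hqN, hNt, hle⟩ := (hloc q).exists_open_le_of_le (hpar q) (hmem q)
    refine ⟨N, hN, hqN, hNt, fun w hw w' hw' => ?_⟩
    rw [h₁.coordSubspaces_eq (hNt hw), h₁.coordSubspaces_eq (hNt hw')]
    exact hle w hw w' hw'
  · refine Or.inr (Or.inr (Or.inl (hrank _ hs h₂.isSmoothDistribution
      (le_of_exists_open (fun q => ?_) (hx h₂ h).le) (hx h₂ h))))
    obtain ⟨N, hN, hqN, hNt, hle⟩ := (hloc q).swap.exists_open_le_of_le (hpar q) (hmem q)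
    refine ⟨N, hN, hqN, hNt, fun w hw w' hw' => ?_⟩
    rw [h₂.coordSubspaces_eq (hNt hw), h₂.coordSubspaces_eq (hNt hw')]
    exact hle w hw w' hw'
  · exact Or.inr (Or.inr (Or.inr (hrank _ hs htop.isSmoothDistribution (fun x => le_top)
      (hx htop h))))

end Global

/-! ### Charts of a product -/

section Product

variable {E₁ : Type*} [NormedAddCommGroup E₁] [NormedSpace ℝ E₁]
  {B₁ : Type*} [TopologicalSpace B₁] {I₁ : ModelWithCorners ℝ E₁ B₁}
  {M₁ : Type*} [TopologicalSpace M₁] [ChartedSpace B₁ M₁] [IsManifold I₁ ∞ M₁]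
  {E₂ : Type*} [NormedAddCommGroup E₂] [NormedSpace ℝ E₂]
  {B₂ : Type*} [TopologicalSpace B₂] {I₂ : ModelWithCorners ℝ E₂ B₂}
  {M₂ : Type*} [TopologicalSpace M₂] [ChartedSpace B₂ M₂] [IsManifold I₂ ∞ M₂]

/-- The coordinates in a product chart are the pairs of coordinates in the two charts. -/
theorem toCoord_prod {p x : M₁ × M₂} (hx₁ : x.1 ∈ (chartAt B₁ p.1).source)
    (hx₂ : x.2 ∈ (chartAt B₂ p.2).source) (w : TangentSpace (I₁.prod I₂) x) :
    toCoord (I₁.prod I₂) p x w = (toCoord I₁ p.1 x.1 w.1, toCoord I₂ p.2 x.2 w.2) := by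
  have hx : x ∈ (chartAt (ModelProd B₁ B₂) p).source := by
    rw [prodChartedSpace_chartAt]; exact ⟨hx₁, hx₂⟩
  rw [toCoord_eq_mfderiv hx, toCoord_eq_mfderiv hx₁, toCoord_eq_mfderiv hx₂, extChartAt_prod,
    PartialEquiv.prod_coe, modelWithCornersSelf_prod, ← chartedSpaceSelf_prod]
  have h1 := mdifferentiableAt_extChartAt (I := I₁) hx₁
  have h2 := mdifferentiableAt_extChartAt (I := I₂) hx₂
  have h3 := mfderiv_prodMap h1 h2
  exact congrArg (fun L => L w) h3

theorem chartAt_source_prod {p x : M₁ × M₂} (hx : x ∈ (chartAt (ModelProd B₁ B₂) p).source) :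
    x.1 ∈ (chartAt B₁ p.1).source ∧ x.2 ∈ (chartAt B₂ p.2).source := by
  rw [prodChartedSpace_chartAt] at hx
  exact hx

theorem isModelledOn_factor₁ :
    IsModelledOn (LinearMap.ker (LinearMap.snd ℝ E₁ E₂)) (factor₁ I₁ M₁ I₂ M₂) := by
  intro p x hx v
  obtain ⟨hx₁, hx₂⟩ := chartAt_source_prod hx
  have h1 := toCoord_prod hx₁ hx₂ (ofCoord (I₁.prod I₂) p x v)
  rw [toCoord_ofCoord hx] at h1
  rw [factor₁, vertical, LinearMap.mem_ker, LinearMap.mem_ker, mfderiv_snd]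
  change (ofCoord (I₁.prod I₂) p x v).2 = 0 ↔ v.2 = 0
  rw [show v.2 = _ from congrArg Prod.snd h1]
  exact (map_eq_zero_iff _ (toCoord_injective hx₂)).symm

theorem isModelledOn_factor₂ :
    IsModelledOn (LinearMap.ker (LinearMap.fst ℝ E₁ E₂)) (factor₂ I₁ M₁ I₂ M₂) := by
  intro p x hx v
  obtain ⟨hx₁, hx₂⟩ := chartAt_source_prod hx
  have h1 := toCoord_prod hx₁ hx₂ (ofCoord (I₁.prod I₂) p x v)
  rw [toCoord_ofCoord hx] at h1
  rw [factor₂, vertical, LinearMap.mem_ker, LinearMap.mem_ker, mfderiv_fst]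
  change (ofCoord (I₁.prod I₂) p x v).1 = 0 ↔ v.1 = 0
  rw [show v.1 = _ from congrArg Prod.fst h1]
  exact (map_eq_zero_iff _ (toCoord_injective hx₁)).symm

end Product

section LinearAlgebra

variable {E₁ E₂ : Type*} [AddCommGroup E₁] [Module ℝ E₁] [AddCommGroup E₂] [Module ℝ E₂]

theorem isCompl_ker_snd_ker_fst :
    IsCompl (LinearMap.ker (LinearMap.snd ℝ E₁ E₂)) (LinearMap.ker (LinearMap.fst ℝ E₁ E₂)) := by
  rw [LinearMap.ker_snd, LinearMap.ker_fst]
  exact LinearMap.isCompl_range_inl_inr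

theorem ker_snd_ne_bot [Nontrivial E₁] : LinearMap.ker (LinearMap.snd ℝ E₁ E₂) ≠ ⊥ := by
  obtain ⟨v, hv⟩ := exists_ne (0 : E₁)
  exact (Submodule.ne_bot_iff _).2 ⟨(v, 0), by simp, by simpa using hv⟩

theorem ker_fst_ne_bot [Nontrivial E₂] : LinearMap.ker (LinearMap.fst ℝ E₁ E₂) ≠ ⊥ := by
  obtain ⟨v, hv⟩ := exists_ne (0 : E₂)
  exact (Submodule.ne_bot_iff _).2 ⟨(0, v), by simp, by simpa using hv⟩

end LinearAlgebra

end WeylGeometry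

end

theorem mainTheorem3 {n₁ n₂ : ℕ} (hn₁ : 1 ≤ n₁) (hn₂ : 1 ≤ n₂)
    (hn2 : n₁ + n₂ ≠ 2) (hn4 : n₁ + n₂ ≠ 4)
    {M₁ : Type*} [TopologicalSpace M₁] [T2Space M₁] [SecondCountableTopology M₁]
    [ConnectedSpace M₁] [ChartedSpace (EuclideanSpace ℝ (Fin n₁)) M₁] [IsManifold (𝓡 n₁) ∞ M₁]
    {M₂ : Type*} [TopologicalSpace M₂] [T2Space M₂] [SecondCountableTopology M₂]
    [ConnectedSpace M₂] [ChartedSpace (EuclideanSpace ℝ (Fin n₂)) M₂] [IsManifold (𝓡 n₂) ∞ M₂]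
    (c₁ : WeylGeometry.ConformalStructure (𝓡 n₁) M₁)
    (c₂ : WeylGeometry.ConformalStructure (𝓡 n₂) M₂)
    (c : WeylGeometry.ConformalStructure ((𝓡 n₁).prod (𝓡 n₂)) (M₁ × M₂))
    (hc : WeylGeometry.IsConformalProduct c₁ c₂ c)
    (D : CovariantDerivative ((𝓡 n₁).prod (𝓡 n₂))
      (EuclideanSpace ℝ (Fin n₁) × EuclideanSpace ℝ (Fin n₂))
      (TangentSpace ((𝓡 n₁).prod (𝓡 n₂)) : M₁ × M₂ → Type _))
    (hD : WeylGeometry.IsAdaptedWeylStructure c D)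
    (hnc : ¬ WeylGeometry.IsClosedWeyl c D)
    (Δ : WeylGeometry.TangentSubspaces ((𝓡 n₁).prod (𝓡 n₂)) (M₁ × M₂)) :
    (WeylGeometry.IsSmoothDistribution Δ ∧ WeylGeometry.IsParallelDistribution D Δ ∧
        Δ ≠ ⊥ ∧ Δ ≠ ⊤) ↔
      Δ = WeylGeometry.factor₁ (𝓡 n₁) M₁ (𝓡 n₂) M₂ ∨
        Δ = WeylGeometry.factor₂ (𝓡 n₁) M₁ (𝓡 n₂) M₂ := by
  have : Nonempty (Fin n₁) := ⟨⟨0, hn₁⟩⟩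
  have : Nonempty (Fin n₂) := ⟨⟨0, hn₂⟩⟩
  have hdim : Module.finrank ℝ (EuclideanSpace ℝ (Fin n₁) × EuclideanSpace ℝ (Fin n₂)) =
      n₁ + n₂ := by simp
  have h₁ := WeylGeometry.isModelledOn_factor₁ (I₁ := 𝓡 n₁) (M₁ := M₁) (I₂ := 𝓡 n₂) (M₂ := M₂)
  have h₂ := WeylGeometry.isModelledOn_factor₂ (I₁ := 𝓡 n₁) (M₁ := M₁) (I₂ := 𝓡 n₂) (M₂ := M₂)
  have hPQ := WeylGeometry.isCompl_ker_snd_ker_fst (E₁ := EuclideanSpace ℝ (Fin n₁))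
    (E₂ := EuclideanSpace ℝ (Fin n₂))
  constructor
  · rintro ⟨hs, hp, hbot, htop⟩
    rcases WeylGeometry.eq_bot_or_eq_or_eq_or_eq_top_of_not_isClosedWeyl hD.weyl hnc hPQ
      WeylGeometry.ker_snd_ne_bot WeylGeometry.ker_fst_ne_bot h₁ h₂ hD.parallel₁ hD.parallel₂
      (by rwa [hdim]) (by rwa [hdim]) hs hp with h | h | h | h
    · exact absurd h hbot
    · exact Or.inl h
    · exact Or.inr h
    · exact absurd h htop
  · rintro (rfl | rfl)
    · exact ⟨h₁.isSmoothDistribution, hD.parallel₁, h₁.ne_bot_and_ne_top hPQ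
        WeylGeometry.ker_snd_ne_bot WeylGeometry.ker_fst_ne_bot⟩
    · exact ⟨h₂.isSmoothDistribution, hD.parallel₂, h₂.ne_bot_and_ne_top hPQ.symm
        WeylGeometry.ker_fst_ne_bot WeylGeometry.ker_snd_ne_bot⟩
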